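/- **Conventions.** *Inverse sequences.* An inverse sequence $\underline X=(X_n,p_n)_{n\in\mathbb N}$ of sets consists of (small) sets $X_n$ and maps $p_n:X_{n+1}\to X_n$; write $p_{nm}:X_m\to X_n$ ($n\le m$) for the composite bonding map. A morphism of inverse sequences $(f_n,\Phi):\underline X\to\underline Y=(Y_n,q_n)$ consists of a function $\Phi:\mathbb N\to\mathbb N$ and maps $f_n:X_{\Phi(n)}\to Y_n$ such that for all $n<n'$ there is $m\ge\Phi(n),\Phi(n')$ with $f_n\circ p_{\Phi(n)m}=q_{nn'}\circ f_{n'}\circ p_{\Phi(n')m}$. The composite of $(f_n,\Phi)$ with $(g_n,\Psi):\underline Y\to\underline Z$ is $(g_n\circ f_{\Psi(n)},\Phi\circ\Psi)$. Two morphisms $(f_n,\Phi),(g_n,\Psi):\underline X\to\underline Y$ are equivalent if every $n$ admits $m\ge\Phi(n),\Psi(n)$ with $f_n\circ p_{\Phi(n)m}=g_n\circ p_{\Psi(n)m}$. **Tower-Set** is the category of inverse sequences of sets and equivalence classes of morphisms of inverse sequences. *Rooted simplicial trees.* A rooted simplicial tree $(T,v)$ is the geometric realization $T$ of a (possibly infinite,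 not necessarily locally finite) combinatorial tree, with the path metric in which every edge has length $1$ and the topology of this metric, together with a vertex $v$, the root. *Coarse maps.* A map $f:X\to Y$ of metric spaces is coarse if it is metrically proper (the preimage of every bounded set is bounded) and bornologous (for every $R>0$ there is $S>0$ such that $d(x,x')<R$ implies $d(f(x),f(x'))<S$). A map $f:(T,v)\to(T',w)$ is rooted if $f(v)=w$. *Rooted coarse homotopy.* Two rooted continuous coarse maps $f,f':(T,v)\to(T',w)$ are rooted coarse homotopic if there is a continuous map $H:T\times[0,1]\to T'$ such that $H(\cdot,0)=f$ and $H(\cdot,1)=f'$; $H(v,t)=w$ for all $t\in[0,1]$; for every $M>0$ there is $N>0$ with $H^{-1}(B(w,M))\subset B(v,N)\times[0,1]$; and $H(\cdot,t)$ is a coarse map for every $t\in[0,1]$. This is an equivalence relation compatible with composition. **Corollary 6.4.** There is an equivalence of categories between **Tower-Set** and the category whose objects are the rooted simplicial trees and whose morphisms are the rooted coarse homotopy classes of rooted continuous coarse maps. -/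

import Mathlib

open CategoryTheory

universe v u

/-!
### Inverse sequences and the category `Tower C`
-/

section Towers


/-- An inverse sequence in `C`: an inverse system in `C` indexed by the natural numbers.
The bonding morphism `X m ⟶ X n` (for `n ≤ m`) is the image of `n ≤ m` under the functor. -/
structure InverseSequence (C : Type u) [Category.{v} C] where
  /-- the inverse system -/
  sys : ℕᵒᵖ ⥤ C

namespace InverseSequence

variable {C : Type u} [Category.{v} C]

/-- The `n`-th term of an inverse sequence. -/
abbrev term (X : InverseSequence C) (n : ℕ) : C := X.sys.obj (Opposite.op n)

/-- The bonding morphism `p n m : X m ⟶ X n` for `n ≤ m`. -/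
abbrev bond (X : InverseSequence C) {n m : ℕ} (h : n ≤ m) : X.term m ⟶ X.term n :=
  X.sys.map (homOfLE h).op

lemma bond_comp (X : InverseSequence C) {n m k : ℕ} (h : n ≤ m) (h' : m ≤ k) :
    X.bond h' ≫ X.bond h = X.bond (h.trans h') := by
  rw [bond, bond, ← X.sys.map_comp]; rfl

lemma bond_comp_assoc (X : InverseSequence C) {n m k : ℕ} (h : n ≤ m) (h' : m ≤ k)
    {Z : C} (f : X.term n ⟶ Z) :
    X.bond h' ≫ X.bond h ≫ f = X.bond (h.trans h') ≫ f := by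
  rw [← Category.assoc, bond_comp]

/-- A morphism of inverse sequences `(f n, Φ)`: a function `Φ : ℕ → ℕ` and morphisms
`f n : X (Φ n) ⟶ Y n` such that, for `n ≤ n'`, the two morphisms from `X` to `Y n` obtained
from `f n` and from `f n'` agree after restriction to some `X m` with `m ≥ Φ n, Φ n'`. -/
structure SeqHom (X Y : InverseSequence C) where
  /-- the index function -/
  index : ℕ → ℕ
  /-- the component morphisms -/
  app : ∀ n, X.term (index n) ⟶ Y.term n
  /-- compatibility with the bonding morphisms -/
  compat : ∀ n n' (h : n ≤ n'), ∃ (m : ℕ) (h₁ : index n ≤ m) (h₂ : index n' ≤ m),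
    X.bond h₁ ≫ app n = X.bond h₂ ≫ app n' ≫ Y.bond h

/-- The identity morphism of an inverse sequence. -/
def SeqHom.id (X : InverseSequence C) : SeqHom X X where
  index := fun n => n
  app := fun n => 𝟙 (X.term n)
  compat := fun n n' h => ⟨n', h, le_rfl, by
    rw [Category.id_comp, Category.comp_id, bond_comp]⟩

/-- Composition of morphisms of inverse sequences:
`(g n, Ψ) ∘ (f n, Φ) = (g n ∘ f (Ψ n), Φ ∘ Ψ)`. -/
def SeqHom.comp {X Y Z : InverseSequence C} (f : SeqHom X Y) (g : SeqHom Y Z) :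
    SeqHom X Z where
  index := fun n => f.index (g.index n)
  app := fun n => f.app (g.index n) ≫ g.app n
  compat := fun n n' h => by
    obtain ⟨m, h₁, h₂, e⟩ := g.compat n n' h
    obtain ⟨k, a₁, a₂, ea⟩ := f.compat _ _ h₁
    obtain ⟨l, b₁, b₂, eb⟩ := f.compat _ _ h₂
    have hk : k ≤ max k l := le_max_left _ _
    have hl : l ≤ max k l := le_max_right _ _
    refine ⟨max k l, a₁.trans hk, b₁.trans hl, ?_⟩
    rw [← bond_comp_assoc X a₁ hk, ← bond_comp_assoc X b₁ hl]
    have ea' := congrArg (fun z => X.bond hk ≫ z ≫ g.app n) ea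
    have eb' := congrArg (fun z => X.bond hl ≫ z ≫ g.app n' ≫ Z.bond h) eb
    simp only [Category.assoc] at ea' eb' ⊢
    rw [ea', eb', bond_comp_assoc, bond_comp_assoc, e]

/-- The category of inverse sequences and morphisms of inverse sequences
(before passing to equivalence classes). -/
instance : Category (InverseSequence C) where
  Hom := SeqHom
  id := SeqHom.id
  comp := SeqHom.comp
  id_comp := by
    intro X Y f
    cases f
    simp [SeqHom.comp, SeqHom.id]
  comp_id := by
    intro X Y f
    cases f
    simp [SeqHom.comp, SeqHom.id]
  assoc := by
    intro W X Y Z f g h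
    simp [SeqHom.comp]

/-- `(f n, Φ) ∼ (g n, Ψ)`: every `n` admits some `m ≥ Φ n, Ψ n` such that `f n` and `g n` agree
after restriction to `X m`. -/
def equivRel : HomRel (InverseSequence C) := fun X Y (f g : SeqHom X Y) =>
  ∀ n, ∃ (m : ℕ) (h₁ : f.index n ≤ m) (h₂ : g.index n ≤ m),
    X.bond h₁ ≫ f.app n = X.bond h₂ ≫ g.app n

/-- `∼` is an equivalence relation compatible with composition, so that the quotient category
below has as morphisms exactly the `∼`-classes. -/
instance : Congruence (equivRel (C := C)) where
  equivalence := by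
    intro X Y
    refine ⟨fun f n => ⟨_, le_rfl, le_rfl, rfl⟩, ?_, ?_⟩
    · intro f g h n
      obtain ⟨m, h₁, h₂, e⟩ := h n
      exact ⟨m, h₂, h₁, e.symm⟩
    · intro f g k h h' n
      obtain ⟨m, h₁, h₂, e⟩ := h n
      obtain ⟨m', h₁', h₂', e'⟩ := h' n
      have a : m ≤ max m m' := le_max_left _ _
      have b : m' ≤ max m m' := le_max_right _ _
      refine ⟨max m m', h₁.trans a, h₂'.trans b, ?_⟩
      rw [← bond_comp_assoc X h₁ a, e, bond_comp_assoc, ← bond_comp_assoc X h₂' b, ← e',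
        bond_comp_assoc]
  comp_left := by
    intro X Y Z (f : SeqHom X Y) (g : SeqHom Y Z) (g' : SeqHom Y Z) h n
    obtain ⟨m, h₁, h₂, e⟩ := h n
    obtain ⟨k, a₁, a₂, ea⟩ := f.compat _ _ h₁
    obtain ⟨l, b₁, b₂, eb⟩ := f.compat _ _ h₂
    have hk : k ≤ max k l := le_max_left _ _
    have hl : l ≤ max k l := le_max_right _ _
    refine ⟨max k l, a₁.trans hk, b₁.trans hl, ?_⟩
    change X.bond _ ≫ f.app _ ≫ g.app n = X.bond _ ≫ f.app _ ≫ g'.app n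
    rw [← bond_comp_assoc X a₁ hk, ← bond_comp_assoc X b₁ hl]
    have ea' := congrArg (fun z => X.bond hk ≫ z ≫ g.app n) ea
    have eb' := congrArg (fun z => X.bond hl ≫ z ≫ g'.app n) eb
    simp only [Category.assoc] at ea' eb' ⊢
    rw [ea', eb', bond_comp_assoc, bond_comp_assoc, e]
  comp_right := by
    intro X Y Z (f : SeqHom X Y) (f' : SeqHom X Y) (g : SeqHom Y Z) h n
    obtain ⟨m, h₁, h₂, e⟩ := h (g.index n)
    refine ⟨m, h₁, h₂, ?_⟩
    change X.bond _ ≫ f.app _ ≫ g.app n = X.bond _ ≫ f'.app _ ≫ g.app n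
    rw [← Category.assoc, e, Category.assoc]

end InverseSequence

/-- The category `Tower-C`: inverse sequences in `C` and equivalence classes of morphisms of
inverse sequences. -/
abbrev Tower (C : Type u) [Category.{v} C] := Quotient (InverseSequence.equivRel (C := C))

/-- `Tower-Set`, for the category `Type u` of (`u`-small) sets. -/
abbrev TowerSet := Tower (Type u)

end Towers

/-!
### Rooted simplicial trees and their geometric realizations
-/

section Trees


/-- The realization, in the real vector space with basis `V`, of the closed edge with endpoints
`a`, `b` (a single vertex when `a = b`). -/
def realEdge {V : Type u} (a b : V) : Set (V →₀ ℝ) :=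
  segment ℝ (Finsupp.single a 1) (Finsupp.single b 1)

/-- The geometric realization of a graph: the union of all its vertices and closed edges in
barycentric coordinates. -/
def GraphRealization {V : Type u} (G : SimpleGraph V) : Type u :=
  {x : V →₀ ℝ // ∃ a b, (a = b ∨ G.Adj a b) ∧ x ∈ realEdge a b}

namespace GraphRealization

variable {V : Type u} {G : SimpleGraph V}

/-- The point of the realization given by a vertex. -/
noncomputable def vertex (G : SimpleGraph V) (a : V) : GraphRealization G :=
  ⟨Finsupp.single a 1, a, a, Or.inl rfl, left_mem_segment _ _ _⟩

/-- `x` and `y` lie on a common closed edge (or are the same vertex). -/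
def OnCommonEdge (x y : GraphRealization G) : Prop :=
  ∃ a b, (a = b ∨ G.Adj a b) ∧ x.1 ∈ realEdge a b ∧ y.1 ∈ realEdge a b

/-- The length of the straight piece between two points of a common edge, every edge having
length `1`: the points `(1 - s) a + s b` and `(1 - t) a + t b` are at distance `|s - t|`. -/
noncomputable def edgeLength (x y : GraphRealization G) : ℝ :=
  (1 / 2) * (x.1 - y.1).sum fun _ r => |r|

/-- `PolyPath x y L`: there is a polygonal path of length `L` from `x` to `y`, that is, a finite
chain of points from `x` to `y`, any two consecutive ones on a common edge, whose pieces have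
total length `L`. -/
inductive PolyPath : GraphRealization G → GraphRealization G → ℝ → Prop
  | refl (x : GraphRealization G) : PolyPath x x 0
  | cons {x y z : GraphRealization G} {L : ℝ} (h : OnCommonEdge x y) (p : PolyPath y z L) :
      PolyPath x z (edgeLength x y + L)

/-- The path distance on the realization: the infimum of the lengths of polygonal paths. -/
noncomputable def pathDist (x y : GraphRealization G) : ℝ := sInf {L | PolyPath x y L}

lemma edgeLength_comm (x y : GraphRealization G) : edgeLength x y = edgeLength y x := by
  have h : y.1 - x.1 = -(x.1 - y.1) := by abel
  simp only [edgeLength]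
  rw [h, Finsupp.sum, Finsupp.sum, Finsupp.support_neg]
  simp [abs_sub_comm]

lemma abs_sub_le_edgeLength (x y : GraphRealization G) (a : V) :
    (1 / 2) * |x.1 a - y.1 a| ≤ edgeLength x y := by
  unfold edgeLength
  have key : |(x.1 - y.1) a| ≤ (x.1 - y.1).sum fun _ r => |r| := by
    by_cases ha : a ∈ (x.1 - y.1).support
    · exact Finset.single_le_sum (f := fun a => |(x.1 - y.1) a|)
        (fun _ _ => abs_nonneg _) ha
    · rw [Finsupp.notMem_support_iff.1 ha, abs_zero]
      exact Finset.sum_nonneg fun _ _ => abs_nonneg _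
  rw [Finsupp.sub_apply] at key
  linarith

namespace PolyPath

lemma append {x y z : GraphRealization G} {L M : ℝ} (p : PolyPath x y L) (q : PolyPath y z M) :
    PolyPath x z (L + M) := by
  induction p with
  | refl x => simpa using q
  | cons h p ih => rw [add_assoc]; exact .cons h (ih q)

lemma single {x y : GraphRealization G} (h : OnCommonEdge x y) :
    PolyPath x y (edgeLength x y) := by
  simpa using PolyPath.cons h (.refl y)

lemma symm {x y : GraphRealization G} {L : ℝ} (p : PolyPath x y L) : PolyPath y x L := by
  induction p with
  | refl x => exact .refl x
  | cons h p ih =>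
    obtain ⟨a, b, hab, hx, hy⟩ := h
    have q := single (x := _) (y := _) ⟨a, b, hab, hy, hx⟩
    rw [edgeLength_comm, add_comm]
    exact ih.append q

lemma abs_sub_le {x y : GraphRealization G} {L : ℝ} (p : PolyPath x y L) (a : V) :
    (1 / 2) * |x.1 a - y.1 a| ≤ L := by
  induction p with
  | refl x => simp
  | @cons x y z L h p ih =>
    have h₁ := abs_sub_le_edgeLength x y a
    have h₂ := _root_.abs_sub_le (x.1 a) (y.1 a) (z.1 a)
    linarith

lemma nonneg {x y : GraphRealization G} {L : ℝ} (p : PolyPath x y L) : 0 ≤ L := by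
  obtain ⟨a, -⟩ := x.2
  exact le_trans (by positivity) (p.abs_sub_le a)

end PolyPath

lemma exists_polyPath (hG : G.Connected) (x y : GraphRealization G) :
    ∃ L, PolyPath x y L := by
  have h₁ : ∀ x : GraphRealization G, ∃ a L, PolyPath x (vertex G a) L := by
    intro x
    obtain ⟨a, b, hab, hx⟩ := x.2
    exact ⟨a, _, .single ⟨a, b, hab, hx, left_mem_segment _ _ _⟩⟩
  have h₂ : ∀ a b : V, G.Walk a b → ∃ L, PolyPath (vertex G a) (vertex G b) L := by
    intro a b w
    induction w with
    | nil => exact ⟨0, .refl _⟩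
    | cons h w ih =>
      obtain ⟨L, p⟩ := ih
      exact ⟨_, .cons ⟨_, _, Or.inr h, left_mem_segment _ _ _, right_mem_segment _ _ _⟩ p⟩
  obtain ⟨a, L, p⟩ := h₁ x
  obtain ⟨b, M, q⟩ := h₁ y
  obtain ⟨w⟩ := hG.preconnected a b
  obtain ⟨N, r⟩ := h₂ a b w
  exact ⟨_, (p.append r).append q.symm⟩

lemma bddBelow_polyPath (x y : GraphRealization G) : BddBelow {L | PolyPath x y L} :=
  ⟨0, fun _ p => p.nonneg⟩

/-- The realization of a connected graph is a metric space under the path distance. -/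
@[reducible]
noncomputable def metricSpace (hG : G.Connected) : MetricSpace (GraphRealization G) where
  dist := pathDist
  dist_self x := le_antisymm (csInf_le (bddBelow_polyPath x x) (.refl x))
    (le_csInf ⟨0, .refl x⟩ fun _ p => p.nonneg)
  dist_comm x y := by
    change sInf _ = sInf _
    congr 1
    ext L
    exact ⟨PolyPath.symm, PolyPath.symm⟩
  dist_triangle x y z := by
    change sInf _ ≤ sInf _ + sInf _
    have hxy : {L | PolyPath x y L}.Nonempty := exists_polyPath hG x y
    have hyz : {L | PolyPath y z L}.Nonempty := exists_polyPath hG y z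
    rw [← sub_le_iff_le_add]
    refine le_csInf hxy fun L p => ?_
    rw [sub_le_comm]
    refine le_csInf hyz fun M q => ?_
    rw [sub_le_iff_le_add']
    exact csInf_le (bddBelow_polyPath x z) (p.append q)
  eq_of_dist_eq_zero := by
    intro x y h
    change sInf _ = 0 at h
    apply Subtype.ext
    ext a
    have : (1 / 2) * |x.1 a - y.1 a| ≤ 0 := by
      rw [← h]
      exact le_csInf (exists_polyPath hG x y) fun L p => p.abs_sub_le a
    have h' : |x.1 a - y.1 a| = 0 := le_antisymm (by linarith) (abs_nonneg _)
    exact sub_eq_zero.1 (abs_eq_zero.1 h')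

end GraphRealization

/-- A rooted simplicial tree: a tree (in the sense of graph theory, possibly infinite and not
locally finite) together with a vertex, its root. -/
structure RootedSimplicialTree where
  /-- the vertices -/
  V : Type u
  /-- the edges -/
  graph : SimpleGraph V
  /-- the graph is a tree: connected and without cycles -/
  isTree : graph.IsTree
  /-- the root -/
  root : V

namespace RootedSimplicialTree

/-- The underlying space of a rooted simplicial tree: its geometric realization, as a metric
space in which each edge has length `1`. Its topology is the one of this metric. -/
def Space (T : RootedSimplicialTree.{u}) : Type u := GraphRealization T.graph

noncomputable instance (T : RootedSimplicialTree.{u}) : MetricSpace T.Space :=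
  GraphRealization.metricSpace T.isTree.connected

/-- The root, as a point of the space. -/
noncomputable def base (T : RootedSimplicialTree.{u}) : T.Space :=
  GraphRealization.vertex T.graph T.root

end RootedSimplicialTree

end Trees

/-!
### Coarse maps and coarse homotopies
-/

section Coarse


/-- A map between metric spaces is metrically proper if preimages of bounded sets are bounded. -/
def MetricallyProper {X Y : Type*} [MetricSpace X] [MetricSpace Y] (f : X → Y) : Prop :=
  ∀ A : Set Y, Bornology.IsBounded A → Bornology.IsBounded (f ⁻¹' A)

/-- A map between metric spaces is bornologous if for all `R > 0` there is `S > 0` such that points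
at distance less than `R` have images at distance less than `S`. -/
def Bornologous {X Y : Type*} [MetricSpace X] [MetricSpace Y] (f : X → Y) : Prop :=
  ∀ R > 0, ∃ S > 0, ∀ x x' : X, dist x x' < R → dist (f x) (f x') < S

/-- A coarse map (bounded coarse structures): metrically proper and bornologous. -/
structure IsCoarseMap {X Y : Type*} [MetricSpace X] [MetricSpace Y] (f : X → Y) : Prop where
  proper : MetricallyProper f
  bornologous : Bornologous f

lemma IsCoarseMap.id (X : Type*) [MetricSpace X] : IsCoarseMap (fun x : X => x) :=
  ⟨fun _ h => h, fun R hR => ⟨R, hR, fun _ _ h => h⟩⟩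

lemma IsCoarseMap.comp {X Y Z : Type*} [MetricSpace X] [MetricSpace Y] [MetricSpace Z]
    {g : Y → Z} {f : X → Y} (hg : IsCoarseMap g) (hf : IsCoarseMap f) :
    IsCoarseMap (fun x => g (f x)) :=
  ⟨fun A hA => hf.proper _ (hg.proper A hA), fun R hR => by
    obtain ⟨S, hS, h⟩ := hf.bornologous R hR
    obtain ⟨Q, hQ, h'⟩ := hg.bornologous S hS
    exact ⟨Q, hQ, fun x x' hx => h' _ _ (h _ _ hx)⟩⟩

/-- A rooted continuous coarse map between rooted simplicial trees. -/
@[ext]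
structure RootedCoarseMap (S T : RootedSimplicialTree.{u}) where
  /-- the underlying continuous map -/
  map : C(S.Space, T.Space)
  /-- it is rooted: it sends the root to the root -/
  map_base : map S.base = T.base
  /-- it is coarse -/
  coarse : IsCoarseMap map

/-- Rooted simplicial trees and rooted continuous coarse maps
(before passing to homotopy classes). -/
noncomputable instance : Category RootedSimplicialTree.{u} where
  Hom := RootedCoarseMap
  id T := ⟨ContinuousMap.id _, rfl, IsCoarseMap.id _⟩
  comp f g := ⟨g.map.comp f.map, by
    rw [ContinuousMap.comp_apply, f.map_base, g.map_base], g.coarse.comp f.coarse⟩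

/-- Rooted coarse homotopy: there is a homotopy `H` from `f` to `g` which is
* rooted: it fixes the root at all times;
* metrically proper: for all `M > 0` there is `N > 0` such that the preimage under `H` of the ball
  of radius `M` around the root is contained in (ball of radius `N` around the root) `× [0, 1]`;
* coarse at each level `t ∈ [0, 1]`. -/
def rootedCoarseHomotopic : HomRel RootedSimplicialTree.{u} :=
  fun S T (f g : RootedCoarseMap S T) =>
    ∃ H : ContinuousMap.Homotopy f.map g.map,
      (∀ t, H (t, S.base) = T.base) ∧
      (∀ M > 0, ∃ N > 0, ∀ t x, H (t, x) ∈ Metric.ball T.base M → x ∈ Metric.ball S.base N) ∧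
      ∀ t, IsCoarseMap fun x => H (t, x)

lemma rootedCoarseHomotopic_refl {S T : RootedSimplicialTree.{u}} (f : RootedCoarseMap S T) :
    rootedCoarseHomotopic f f := by
  refine ⟨.refl f.map, fun t => f.map_base, fun M hM => ?_, fun t => f.coarse⟩
  obtain ⟨N, hN, h⟩ :=
    (f.coarse.proper (Metric.ball T.base M) Metric.isBounded_ball).subset_ball_lt 0 S.base
  exact ⟨N, hN, fun t x hx => h hx⟩

lemma rootedCoarseHomotopic_comp {S T U : RootedSimplicialTree.{u}}
    {f f' : RootedCoarseMap S T} {g g' : RootedCoarseMap T U}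
    (hf : rootedCoarseHomotopic f f') (hg : rootedCoarseHomotopic g g') :
    rootedCoarseHomotopic ((f : S ⟶ T) ≫ (g : T ⟶ U)) ((f' : S ⟶ T) ≫ (g' : T ⟶ U)) := by
  obtain ⟨H, h₁, h₂, h₃⟩ := hf
  obtain ⟨K, k₁, k₂, k₃⟩ := hg
  refine ⟨K.comp H, fun t => ?_, fun M hM => ?_, fun t => (k₃ t).comp (h₃ t)⟩
  · change K (t, H (t, S.base)) = _
    rw [h₁, k₁]
  · obtain ⟨N, hN, hK⟩ := k₂ M hM
    obtain ⟨P, hP, hH⟩ := h₂ N hN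
    exact ⟨P, hP, fun t x hx => hH t x (hK t _ hx)⟩

/-- Rooted coarse homotopy is an equivalence relation compatible with composition, so that the
quotient category below has as morphisms exactly the rooted coarse homotopy classes. -/
instance : Congruence rootedCoarseHomotopic.{u} where
  equivalence := by
    intro S T
    refine ⟨rootedCoarseHomotopic_refl, ?_, ?_⟩
    · rintro f g ⟨H, h₁, h₂, h₃⟩
      refine ⟨H.symm, fun t => h₁ _, fun M hM => ?_,
        fun t => h₃ (unitInterval.symm t)⟩
      obtain ⟨N, hN, h⟩ := h₂ M hM
      exact ⟨N, hN, fun t x hx => h _ x hx⟩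
    · rintro f g k ⟨H, h₁, h₂, h₃⟩ ⟨K, k₁, k₂, k₃⟩
      have key : ∀ t, (∃ s, ∀ x, (H.trans K) (t, x) = H (s, x)) ∨
          ∃ s, ∀ x, (H.trans K) (t, x) = K (s, x) := by
        intro t
        by_cases ht : (t : ℝ) ≤ 1 / 2
        · exact Or.inl ⟨⟨2 * t, (unitInterval.mul_pos_mem_iff zero_lt_two).2 ⟨t.2.1, ht⟩⟩,
            fun x => by rw [ContinuousMap.Homotopy.trans_apply, dif_pos ht]⟩
        · exact Or.inr ⟨⟨2 * t - 1,
            unitInterval.two_mul_sub_one_mem_iff.2 ⟨(not_le.1 ht).le, t.2.2⟩⟩,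
            fun x => by rw [ContinuousMap.Homotopy.trans_apply, dif_neg ht]⟩
      refine ⟨H.trans K, fun t => ?_, fun M hM => ?_, fun t => ?_⟩
      · obtain ⟨s, hs⟩ | ⟨s, hs⟩ := key t
        · rw [hs, h₁]
        · rw [hs, k₁]
      · obtain ⟨N, hN, h⟩ := h₂ M hM
        obtain ⟨P, hP, h'⟩ := k₂ M hM
        refine ⟨max N P, lt_max_of_lt_left hN, fun t x hx => ?_⟩
        obtain ⟨s, hs⟩ | ⟨s, hs⟩ := key t
        · rw [hs] at hx
          exact Metric.ball_subset_ball (le_max_left _ _) (h s x hx)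
        · rw [hs] at hx
          exact Metric.ball_subset_ball (le_max_right _ _) (h' s x hx)
      · obtain ⟨s, hs⟩ | ⟨s, hs⟩ := key t
        · simpa only [hs] using h₃ s
        · simpa only [hs] using k₃ s
  comp_left f _ _ h := rootedCoarseHomotopic_comp (rootedCoarseHomotopic_refl f) h
  comp_right g h := rootedCoarseHomotopic_comp h (rootedCoarseHomotopic_refl g)

/-- The category of rooted simplicial trees whose morphisms are the rooted coarse homotopy classes
of rooted continuous coarse maps. -/
abbrev CoarseTreeCat := Quotient rootedCoarseHomotopic.{u}

end Coarse

/-! Seen coarsely, a rooted tree is the inverse sequence of its levels: level `n` is the set of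
vertices at depth `n`, bonded by passing to ancestors. The equivalence is the resulting functor
`levelsFunctor`.

The tool is the truncation `trunc n`, the retraction onto the ball of radius `n` about the root. It
sends points of height at least `n` to vertices of depth `n`. Vertices are uniformly separated, so
`trunc n` is constant on connected families of such points (`trunc_eq_of_preconnectedSpace`). For a
proper map `f`, far from the root `trunc n ∘ f` therefore depends only on the ancestor at a suitable
level. This yields a morphism of sequences, unique up to equivalence and invariant under proper
homotopy (`exists_represents`, `Represents.equivRel`, `Represents.of_homotopic`).

Faithfulness (`homotopic_of_represents`): if `f` and `g` induce the same class, their truncations at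
each `n` agree far out. Truncating both at a level `κ` that tends to infinity slowly enough makes
them equal, and sliding the truncation level is a rooted coarse homotopy from each map to its
truncation.

Fullness (`exists_rootedCoarseMap_represents`): a vertex is sent to the deepest level on which the
given morphism already has a compatible value there. Since the thresholds increase strictly, edges
go to edges or vertices.

Essential surjectivity: the disjoint union of the terms, hung on a new root, is a tree whose levels
are the original sequence shifted by one, and a shift is an isomorphism in Tower-Set. -/

namespace RootedSimplicialTree

/-! ### Depth, parents and ancestors in a rooted tree -/

variable (T : RootedSimplicialTree.{u})

/-- The distance of a vertex from the root. -/
noncomputable def depth (v : T.V) : ℕ := T.graph.dist T.root v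

@[simp]
lemma depth_root : T.depth T.root = 0 := SimpleGraph.dist_self

lemma eq_root_of_depth_eq_zero {v : T.V} (h : T.depth v = 0) : v = T.root :=
  ((T.isTree.connected T.root v).dist_eq_zero_iff.1 h).symm

lemma depth_eq_add_one_of_adj {a b : T.V} (h : T.graph.Adj a b) :
    T.depth a = T.depth b + 1 ∨ T.depth b = T.depth a + 1 :=
  T.isTree.dist_eq_dist_add_one_of_adj T.root h

/-- The second vertex of a geodesic from `v` to the root. -/
lemma exists_adj_depth {v : T.V} (h : T.depth v ≠ 0) :
    ∃ a, T.graph.Adj a v ∧ T.depth a + 1 = T.depth v := by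
  obtain ⟨p, hp⟩ := T.isTree.connected.exists_walk_length_eq_dist v T.root
  cases p with
  | nil => simp at h
  | @cons _ a _ hadj q =>
    refine ⟨a, hadj.symm, ?_⟩
    have h₁ : T.depth a ≤ q.length := by
      rw [depth, SimpleGraph.dist_comm]; exact SimpleGraph.dist_le q
    have h₂ : q.length + 1 = T.depth v := by
      rw [depth, SimpleGraph.dist_comm, ← hp]; simp
    have := T.depth_eq_add_one_of_adj hadj
    omega

/-- Geodesics to `a` and to `b`, each prolonged by one edge, are paths from the root to `v`, and a
tree has only one. -/
lemma eq_of_adj_of_depth {a b v : T.V} (ha : T.graph.Adj a v) (hb : T.graph.Adj b v)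
    (hda : T.depth a + 1 = T.depth v) (hdb : T.depth b + 1 = T.depth v) : a = b := by
  obtain ⟨p, hp⟩ := T.isTree.connected.exists_walk_length_eq_dist T.root a
  obtain ⟨q, hq⟩ := T.isTree.connected.exists_walk_length_eq_dist T.root b
  have hp' : (p.concat ha).IsPath := (p.concat ha).isPath_of_length_eq_dist (by
    rw [SimpleGraph.Walk.length_concat, hp]; exact hda)
  have hq' : (q.concat hb).IsPath := (q.concat hb).isPath_of_length_eq_dist (by
    rw [SimpleGraph.Walk.length_concat, hq]; exact hdb)
  have := (T.isTree.existsUnique_path T.root v).unique hp' hq'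
  rw [← SimpleGraph.Walk.penultimate_concat p ha, this, SimpleGraph.Walk.penultimate_concat]

open Classical in
/-- The parent of a vertex; the root is its own parent. -/
noncomputable def par (v : T.V) : T.V :=
  if h : T.depth v ≠ 0 then (T.exists_adj_depth h).choose else v

lemma adj_par {v : T.V} (h : T.depth v ≠ 0) : T.graph.Adj (T.par v) v := by
  rw [par, dif_pos h]
  exact (T.exists_adj_depth h).choose_spec.1

@[simp]
lemma depth_par (v : T.V) : T.depth (T.par v) = T.depth v - 1 := by
  by_cases h : T.depth v ≠ 0
  · have := (T.exists_adj_depth h).choose_spec.2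
    rw [par, dif_pos h]
    omega
  · rw [par, dif_neg h]
    omega

lemma par_eq_of_adj {a v : T.V} (h : T.graph.Adj a v) (hd : T.depth v = T.depth a + 1) :
    T.par v = a :=
  T.eq_of_adj_of_depth (T.adj_par (by omega)) h (by simp; omega) hd.symm

lemma eq_or_adj_par (v : T.V) : T.par v = v ∨ T.graph.Adj (T.par v) v := by
  by_cases h : T.depth v ≠ 0
  · exact Or.inr (T.adj_par h)
  · rw [par, dif_neg h]; exact Or.inl rfl

lemma par_eq_or_par_eq {a b : T.V} (h : a = b ∨ T.graph.Adj a b) :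
    a = b ∨ (T.par b = a ∧ T.depth b = T.depth a + 1) ∨
      (T.par a = b ∧ T.depth a = T.depth b + 1) := by
  refine h.imp id fun h => ?_
  rcases T.depth_eq_add_one_of_adj h with hd | hd
  · exact Or.inr ⟨T.par_eq_of_adj h.symm hd, hd⟩
  · exact Or.inl ⟨T.par_eq_of_adj h hd, hd⟩

lemma depth_par_iterate (k : ℕ) (v : T.V) : T.depth (T.par^[k] v) = T.depth v - k := by
  induction k generalizing v with
  | zero => rfl
  | succ k ih => rw [Function.iterate_succ_apply, ih, depth_par]; omega

/-- The ancestor of `v` at depth `n`, or `v` itself when `v` has depth at most `n`. -/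
noncomputable def anc (n : ℕ) (v : T.V) : T.V := T.par^[T.depth v - n] v

@[simp]
lemma depth_anc (n : ℕ) (v : T.V) : T.depth (T.anc n v) = min n (T.depth v) := by
  rw [anc, depth_par_iterate]; omega

lemma anc_of_depth_le {n : ℕ} {v : T.V} (h : T.depth v ≤ n) : T.anc n v = v := by
  rw [anc, Nat.sub_eq_zero_of_le h]; rfl

lemma anc_anc (n m : ℕ) (v : T.V) : T.anc n (T.anc m v) = T.anc (min n m) v := by
  rw [anc, depth_anc, anc, anc, ← Function.iterate_add_apply]
  congr 1; omega

lemma anc_par {n : ℕ} {v : T.V} (h : n < T.depth v) : T.anc n (T.par v) = T.anc n v := by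
  rw [anc, depth_par, anc, ← Function.iterate_succ_apply]
  congr 1; omega

lemma par_anc_succ {n : ℕ} {v : T.V} (h : n < T.depth v) :
    T.par (T.anc (n + 1) v) = T.anc n v := by
  rw [anc, anc, ← Function.iterate_succ_apply' T.par]
  congr 1; omega

@[simp]
lemma anc_zero (v : T.V) : T.anc 0 v = T.root := T.eq_root_of_depth_eq_zero (by simp)

/-- The edge into which truncation at depths `n` and `n + 1` sends a given edge. -/
lemma exists_edge_anc (n : ℕ) {a b : T.V} (h : a = b ∨ T.graph.Adj a b) :
    ∃ c d, (c = d ∨ T.graph.Adj c d) ∧ (T.anc n a = c ∨ T.anc n a = d) ∧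
      (T.anc n b = c ∨ T.anc n b = d) ∧ (T.anc (n + 1) a = c ∨ T.anc (n + 1) a = d) ∧
      (T.anc (n + 1) b = c ∨ T.anc (n + 1) b = d) := by
  -- The claim is symmetric in the two endpoints, so one orientation suffices.
  have key : ∀ a b, T.par b = a → T.depth b ≤ T.depth a + 1 →
    ∃ c d, (c = d ∨ T.graph.Adj c d) ∧ (T.anc n a = c ∨ T.anc n a = d) ∧
      (T.anc n b = c ∨ T.anc n b = d) ∧ (T.anc (n + 1) a = c ∨ T.anc (n + 1) a = d) ∧
      (T.anc (n + 1) b = c ∨ T.anc (n + 1) b = d) := by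
    rintro _ b rfl hd
    by_cases hb : T.depth b ≤ n
    · have ha : T.depth (T.par b) ≤ n := by simp; omega
      rw [T.anc_of_depth_le hb, T.anc_of_depth_le ha, T.anc_of_depth_le (hb.trans n.le_succ),
        T.anc_of_depth_le (ha.trans n.le_succ)]
      exact ⟨_, _, T.eq_or_adj_par b, by simp⟩
    · push Not at hb
      -- Beyond depth `n` all four truncations lie on the last edge of the branch towards `b` cut at
      -- depth `n + 1`.
      refine ⟨_, _, T.eq_or_adj_par (T.anc (n + 1) b), ?_⟩
      rw [T.par_anc_succ hb, T.anc_par hb]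
      refine ⟨by simp, by simp, ?_, by simp⟩
      by_cases hb' : n + 1 < T.depth b
      · rw [T.anc_par hb']; simp
      · rw [T.anc_of_depth_le (v := T.par b) (by simp; omega), ← T.anc_par hb,
          T.anc_of_depth_le (v := T.par b) (by simp; omega)]
        simp
  rcases T.par_eq_or_par_eq h with rfl | ⟨h, hd⟩ | ⟨h, hd⟩
  · refine ⟨_, _, T.eq_or_adj_par (T.anc (n + 1) a), ?_⟩
    by_cases ha : n < T.depth a
    · rw [T.par_anc_succ ha]; simp
    · rw [T.anc_of_depth_le (v := a) (n := n) (by omega), T.anc_of_depth_le (v := a) (by omega)]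
      simp
  · exact key a b h hd.le
  · obtain ⟨c, d, h₁, h₂, h₃, h₄, h₅⟩ := key b a h hd.le
    exact ⟨c, d, h₁, h₃, h₂, h₅, h₄⟩

end RootedSimplicialTree

/-! ### The `ℓ¹` norm and contractions given by linear maps -/

namespace Finsupp

variable {V W : Type*}

/-- The `ℓ¹` norm of a finitely supported function. -/
noncomputable def l1 (z : V →₀ ℝ) : ℝ := z.sum fun _ r => |r|

lemma l1_eq_sum {z : V →₀ ℝ} {s : Finset V} (h : z.support ⊆ s) : z.l1 = ∑ a ∈ s, |z a| :=
  Finsupp.sum_of_support_subset z h _ (by simp)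

@[simp]
lemma l1_zero : (0 : V →₀ ℝ).l1 = 0 := Finsupp.sum_zero_index

@[simp]
lemma l1_single (a : V) (r : ℝ) : (single a r).l1 = |r| := Finsupp.sum_single_index abs_zero

lemma l1_add_le (z w : V →₀ ℝ) : (z + w).l1 ≤ z.l1 + w.l1 := by
  classical
  rw [l1_eq_sum (z := z) Finset.subset_union_left, l1_eq_sum (z := w) Finset.subset_union_right,
    l1_eq_sum Finsupp.support_add, ← Finset.sum_add_distrib]
  exact Finset.sum_le_sum fun a _ => abs_add_le _ _

lemma l1_smul (c : ℝ) (z : V →₀ ℝ) : (c • z).l1 = |c| * z.l1 := by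
  rw [l1_eq_sum (z := c • z) Finsupp.support_smul, l1_eq_sum (subset_refl z.support),
    Finset.mul_sum]
  exact Finset.sum_congr rfl fun a _ => by simp [abs_mul]

lemma l1_sub_le (z w : V →₀ ℝ) : (z - w).l1 ≤ z.l1 + w.l1 := by
  have h : z - w = z + (-1 : ℝ) • w := by simp [sub_eq_add_neg]
  rw [h]
  refine (l1_add_le _ _).trans ?_
  rw [l1_smul]; simp

/-- Coordinates can only merge or cancel. As edge lengths are half `ℓ¹` norms, this is what makes
vertex maps contract distances. -/
lemma l1_mapDomain_le (f : V → W) (z : V →₀ ℝ) : (z.mapDomain f).l1 ≤ z.l1 := by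
  classical
  rw [Finsupp.mapDomain, Finsupp.sum]
  refine (Finset.le_sum_of_subadditive _ l1_zero.le l1_add_le _ _).trans ?_
  rw [l1_eq_sum (subset_refl z.support)]
  exact Finset.sum_le_sum fun a _ => by simp

end Finsupp

lemma mem_realEdge_iff {V : Type u} {a b : V} {x : V →₀ ℝ} :
    x ∈ realEdge a b ↔ ∃ s : ℝ, 0 ≤ s ∧ s ≤ 1 ∧
      x = (1 - s) • Finsupp.single a 1 + s • Finsupp.single b 1 := by
  rw [realEdge, segment_eq_image]
  constructor
  · rintro ⟨s, ⟨h₀, h₁⟩, rfl⟩; exact ⟨s, h₀, h₁, rfl⟩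
  · rintro ⟨s, h₀, h₁, rfl⟩; exact ⟨s, ⟨h₀, h₁⟩, rfl⟩

lemma convex_realEdge {V : Type u} (a b : V) : Convex ℝ (realEdge a b) := convex_segment _ _

lemma single_left_mem_realEdge {V : Type u} (a b : V) : Finsupp.single a 1 ∈ realEdge a b :=
  left_mem_segment _ _ _

lemma single_right_mem_realEdge {V : Type u} (a b : V) : Finsupp.single b 1 ∈ realEdge a b :=
  right_mem_segment _ _ _

namespace GraphRealization

variable {V W : Type u} {G : SimpleGraph V} {H : SimpleGraph W}

lemma l1_le_one (x : GraphRealization G) : x.1.l1 ≤ 1 := by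
  obtain ⟨a, b, -, hx⟩ := x.2
  obtain ⟨s, h₀, h₁, e⟩ := mem_realEdge_iff.1 hx
  rw [e]
  refine (Finsupp.l1_add_le _ _).trans ?_
  rw [Finsupp.l1_smul, Finsupp.l1_smul, Finsupp.l1_single, Finsupp.l1_single, abs_of_nonneg h₀,
    abs_of_nonneg (sub_nonneg.2 h₁)]
  simp

lemma pathDist_le_edgeLength {x y : GraphRealization G} (h : OnCommonEdge x y) :
    pathDist x y ≤ edgeLength x y :=
  csInf_le (bddBelow_polyPath x y) (.single h)

/-- A linear map which sends edges into edges and does not increase the `ℓ¹` norm. -/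
structure LinearEdgeMap (G : SimpleGraph V) (H : SimpleGraph W) where
  /-- the underlying linear map -/
  lin : (V →₀ ℝ) →ₗ[ℝ] (W →₀ ℝ)
  /-- edges are sent into edges -/
  edge : ∀ a b, (a = b ∨ G.Adj a b) → ∃ c d, (c = d ∨ H.Adj c d) ∧
    lin (Finsupp.single a 1) ∈ realEdge c d ∧ lin (Finsupp.single b 1) ∈ realEdge c d
  /-- the `ℓ¹` norm does not increase -/
  l1_le : ∀ z, (lin z).l1 ≤ z.l1

namespace LinearEdgeMap

lemma exists_edge (L : LinearEdgeMap G H) {a b : V} (h : a = b ∨ G.Adj a b) :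
    ∃ c d, (c = d ∨ H.Adj c d) ∧ ∀ x ∈ realEdge a b, L.lin x ∈ realEdge c d := by
  obtain ⟨c, d, hcd, ha, hb⟩ := L.edge a b h
  refine ⟨c, d, hcd, fun x hx => ?_⟩
  obtain ⟨s, h₀, h₁, rfl⟩ := mem_realEdge_iff.1 hx
  rw [map_add, map_smul, map_smul]
  exact convex_realEdge c d ha hb (sub_nonneg.2 h₁) h₀ (by ring)

/-- The map of realizations given by a linear map sending edges into edges. -/
noncomputable def toMap (L : LinearEdgeMap G H) (x : GraphRealization G) : GraphRealization H :=
  ⟨L.lin x.1, by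
    obtain ⟨a, b, hab, hx⟩ := x.2
    obtain ⟨c, d, hcd, h⟩ := L.exists_edge hab
    exact ⟨c, d, hcd, h _ hx⟩⟩

/-- The image of a chain is again a chain, and by linearity the norm bound applies to the difference
of consecutive points. -/
lemma polyPath (L : LinearEdgeMap G H) {x y : GraphRealization G} {l : ℝ} (p : PolyPath x y l) :
    ∃ l' ≤ l, PolyPath (L.toMap x) (L.toMap y) l' := by
  induction p with
  | refl x => exact ⟨0, le_rfl, .refl _⟩
  | @cons x y z l h p ih =>
    obtain ⟨l', hl, q⟩ := ih
    obtain ⟨a, b, hab, hx, hy⟩ := h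
    obtain ⟨c, d, hcd, h⟩ := L.exists_edge hab
    refine ⟨_, ?_, .cons ⟨c, d, hcd, h _ hx, h _ hy⟩ q⟩
    refine add_le_add ?_ hl
    have := L.l1_le (x.1 - y.1)
    rw [map_sub] at this
    exact mul_le_mul_of_nonneg_left this (by norm_num)

lemma pathDist_le (L : LinearEdgeMap G H) (hG : G.Connected) (x y : GraphRealization G) :
    pathDist (L.toMap x) (L.toMap y) ≤ pathDist x y := by
  refine le_csInf (exists_polyPath hG x y) fun l p => ?_
  obtain ⟨l', hl, q⟩ := L.polyPath p
  exact (csInf_le (bddBelow_polyPath _ _) q).trans hl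

/-- The linear map given by a map of vertices sending adjacent vertices to adjacent or equal
vertices. -/
noncomputable def ofVertexMap (φ : V → W) (h : ∀ a b, G.Adj a b → φ a = φ b ∨ H.Adj (φ a) (φ b)) :
    LinearEdgeMap G H where
  lin := Finsupp.lmapDomain ℝ ℝ φ
  edge a b hab := by
    refine ⟨φ a, φ b, hab.elim (fun e => Or.inl (congrArg φ e)) (h a b), ?_⟩
    simp only [Finsupp.lmapDomain_apply, Finsupp.mapDomain_single]
    exact ⟨single_left_mem_realEdge _ _, single_right_mem_realEdge _ _⟩
  l1_le z := Finsupp.l1_mapDomain_le φ z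

end LinearEdgeMap

end GraphRealization

/-! ### Vertices and the height function -/

namespace RootedSimplicialTree

variable {S T : RootedSimplicialTree.{u}}

lemma dist_le_edgeLength {x y : T.Space} (h : GraphRealization.OnCommonEdge x y) :
    dist x y ≤ GraphRealization.edgeLength x y :=
  GraphRealization.pathDist_le_edgeLength h

lemma dist_toMap_le (L : GraphRealization.LinearEdgeMap S.graph T.graph) (x y : S.Space) :
    dist (α := T.Space) (L.toMap x) (L.toMap y) ≤ dist x y :=
  L.pathDist_le S.isTree.connected x y

lemma le_dist_of_le_polyPath {x y : T.Space} {c : ℝ}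
    (h : ∀ l, GraphRealization.PolyPath x y l → c ≤ l) : c ≤ dist x y :=
  le_csInf (GraphRealization.exists_polyPath T.isTree.connected x y) h

variable (T)

/-- The point of the space given by a vertex. -/
noncomputable def pt (a : T.V) : T.Space := GraphRealization.vertex T.graph a

lemma pt_val (a : T.V) : (T.pt a).1 = Finsupp.single a 1 := rfl

lemma pt_root : T.pt T.root = T.base := rfl

variable {T}

/-- Between distinct vertices the coordinate at `a` changes by `1`, and a path of length `l` changes
a coordinate by at most `2 * l`. The bound is not sharp, but uniform separation is all that is
needed. -/
lemma eq_of_dist_pt_lt {a b : T.V} (h : dist (T.pt a) (T.pt b) < 1 / 2) : a = b := by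
  by_contra hab
  have : 1 / 2 ≤ dist (T.pt a) (T.pt b) := le_dist_of_le_polyPath fun l p => by
    have := p.abs_sub_le a
    rw [pt_val, pt_val, Finsupp.single_eq_same, Finsupp.single_eq_of_ne hab] at this
    simpa using this
  linarith

lemma pt_injective : Function.Injective T.pt := fun a b h =>
  eq_of_dist_pt_lt (by rw [h, dist_self]; norm_num)

/-- Every point lies on the edge between some vertex and its parent. -/
lemma exists_eq_par (x : T.Space) : ∃ (b : T.V) (s : ℝ), 0 ≤ s ∧ s ≤ 1 ∧
    x.1 = (1 - s) • Finsupp.single (T.par b) 1 + s • Finsupp.single b 1 := by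
  obtain ⟨a, b, hab, hx⟩ := x.2
  obtain ⟨s, h₀, h₁, e⟩ := mem_realEdge_iff.1 hx
  rcases T.par_eq_or_par_eq hab with rfl | ⟨h, -⟩ | ⟨h, -⟩
  · refine ⟨a, 1, zero_le_one, le_rfl, ?_⟩
    rw [e, ← add_smul]; simp
  · exact ⟨b, s, h₀, h₁, by rw [h, e]⟩
  · refine ⟨a, 1 - s, by linarith, by linarith, ?_⟩
    rw [h, e, add_comm]; simp

/-- Points on an edge from a parent, up to a boundary case at the top. -/
lemma exists_eq_par_of_pos (x : T.Space) : (∃ a, x = T.pt a) ∨ ∃ (b : T.V) (s : ℝ), 0 < s ∧ s ≤ 1 ∧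
    T.depth b = T.depth (T.par b) + 1 ∧
    x.1 = (1 - s) • Finsupp.single (T.par b) 1 + s • Finsupp.single b 1 := by
  obtain ⟨b, s, h₀, h₁, e⟩ := exists_eq_par x
  rcases h₀.eq_or_lt with rfl | h₀
  · exact Or.inl ⟨T.par b, Subtype.ext (by rw [e, pt_val]; simp)⟩
  by_cases hb : T.depth b = 0
  · refine Or.inl ⟨b, Subtype.ext ?_⟩
    have : T.par b = b := (T.eq_root_of_depth_eq_zero (by simp [hb])).trans
      (T.eq_root_of_depth_eq_zero hb).symm
    rw [e, this, pt_val, ← add_smul]; simp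
  · exact Or.inr ⟨b, s, h₀, h₁, by simp; omega, e⟩

/-- The height of a point: the affine extension of the depth of vertices. -/
noncomputable def ht (x : T.Space) : ℝ :=
  Finsupp.linearCombination ℝ (fun v => (T.depth v : ℝ)) x.1

@[simp]
lemma ht_pt (a : T.V) : ht (T.pt a) = T.depth a := by simp [ht, pt_val]

@[simp]
lemma ht_base : ht T.base = 0 := by simp [← pt_root]

lemma ht_of_eq {x : T.Space} {a b : T.V} {s : ℝ}
    (h : x.1 = (1 - s) • Finsupp.single a 1 + s • Finsupp.single b 1) :
    ht x = (1 - s) * T.depth a + s * T.depth b := by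
  rw [ht, h]; simp; ring

lemma ht_nonneg (x : T.Space) : 0 ≤ ht x := by
  obtain ⟨b, s, h₀, h₁, e⟩ := exists_eq_par x
  rw [ht_of_eq e]
  have := sub_nonneg.2 h₁
  positivity

/-- Height is affine of slope at most `1` along an edge. The factor `2` comes from bounding the edge
length below by a single coordinate; any constant would serve. -/
lemma abs_ht_sub_le_edgeLength {x y : T.Space} (h : GraphRealization.OnCommonEdge x y) :
    |ht x - ht y| ≤ 2 * GraphRealization.edgeLength x y := by
  obtain ⟨a, b, hab, hx, hy⟩ := h
  obtain ⟨s, -, -, ex⟩ := mem_realEdge_iff.1 hx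
  obtain ⟨t, -, -, ey⟩ := mem_realEdge_iff.1 hy
  have hb := GraphRealization.abs_sub_le_edgeLength x y b
  rw [ht_of_eq ex, ht_of_eq ey]
  rcases eq_or_ne a b with rfl | hne
  · have : (1 - s) * (T.depth a : ℝ) + s * T.depth a - ((1 - t) * T.depth a + t * T.depth a) = 0 := by
      ring
    rw [this, abs_zero]
    have := abs_nonneg (x.1 a - y.1 a)
    linarith
  · have e : x.1 b - y.1 b = s - t := by
      rw [ex, ey]; simp [Finsupp.single_eq_of_ne hne.symm]
    rw [e] at hb
    have hd : |(T.depth b : ℝ) - T.depth a| ≤ 1 := by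
      rcases T.par_eq_or_par_eq hab with h | ⟨-, h⟩ | ⟨-, h⟩
      · exact absurd h hne
      · rw [h]; simp
      · rw [h]; simp
    have : (1 - s) * (T.depth a : ℝ) + s * T.depth b - ((1 - t) * T.depth a + t * T.depth b) =
        (s - t) * (T.depth b - T.depth a) := by ring
    rw [this, abs_mul]
    have := mul_le_mul_of_nonneg_left hd (abs_nonneg (s - t))
    linarith

lemma abs_ht_sub_le_dist (x y : T.Space) : |ht x - ht y| ≤ 2 * dist x y := by
  suffices 1 / 2 * |ht x - ht y| ≤ dist x y by linarith
  refine le_dist_of_le_polyPath fun l p => ?_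
  suffices |ht x - ht y| ≤ 2 * l by linarith
  induction p with
  | refl x => simp
  | @cons x y z l h p ih =>
    have h₁ := abs_ht_sub_le_edgeLength h
    have h₂ := abs_sub_le (ht x) (ht y) (ht z)
    linarith

lemma ht_le_dist (x : T.Space) : ht x ≤ 2 * dist x T.base := by
  have := abs_ht_sub_le_dist x T.base
  rw [ht_base, sub_zero, abs_of_nonneg (ht_nonneg x)] at this
  exact this

lemma continuous_ht : Continuous (ht : T.Space → ℝ) :=
  (LipschitzWith.of_dist_le_mul (K := 2) fun x y => by
    rw [Real.dist_eq]; exact abs_ht_sub_le_dist x y).continuous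

end RootedSimplicialTree

/-! ### Truncation of points at real levels -/

namespace RootedSimplicialTree

open GraphRealization

variable {S T : RootedSimplicialTree.{u}}

variable (T) in
/-- Truncation at depth `n`, as a linear map. -/
noncomputable def ancLin (n : ℕ) : (T.V →₀ ℝ) →ₗ[ℝ] (T.V →₀ ℝ) := Finsupp.lmapDomain ℝ ℝ (T.anc n)

@[simp]
lemma ancLin_single (n : ℕ) (a : T.V) (r : ℝ) :
    T.ancLin n (Finsupp.single a r) = Finsupp.single (T.anc n a) r := by
  simp [ancLin]

lemma ancLin_ancLin (n m : ℕ) (z : T.V →₀ ℝ) :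
    T.ancLin n (T.ancLin m z) = T.ancLin (min n m) z := by
  simp only [ancLin, Finsupp.lmapDomain_apply, ← Finsupp.mapDomain_comp]
  congr 1
  funext v
  exact T.anc_anc n m v

variable (T) in
/-- The interpolation of the truncations at depths `n` and `n + 1`. -/
noncomputable def truncLin (n : ℕ) (s : ℝ) (h₀ : 0 ≤ s) (h₁ : s ≤ 1) :
    LinearEdgeMap T.graph T.graph where
  lin := (1 - s) • T.ancLin n + s • T.ancLin (n + 1)
  edge a b hab := by
    obtain ⟨c, d, hcd, h₁', h₂, h₃, h₄⟩ := T.exists_edge_anc n hab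
    have key : ∀ v, (v = c ∨ v = d) → Finsupp.single v (1 : ℝ) ∈ realEdge c d := by
      rintro v (rfl | rfl)
      · exact single_left_mem_realEdge _ _
      · exact single_right_mem_realEdge _ _
    refine ⟨c, d, hcd, ?_, ?_⟩
    · simp only [LinearMap.add_apply, LinearMap.smul_apply, ancLin_single]
      exact convex_realEdge c d (key _ h₁') (key _ h₃) (sub_nonneg.2 h₁) h₀ (by ring)
    · simp only [LinearMap.add_apply, LinearMap.smul_apply, ancLin_single]
      exact convex_realEdge c d (key _ h₂) (key _ h₄) (sub_nonneg.2 h₁) h₀ (by ring)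
  l1_le z := by
    refine (Finsupp.l1_add_le _ _).trans ?_
    simp only [LinearMap.smul_apply]
    rw [Finsupp.l1_smul, Finsupp.l1_smul, abs_of_nonneg h₀, abs_of_nonneg (sub_nonneg.2 h₁)]
    have a₁ : (T.ancLin n z).l1 ≤ z.l1 := Finsupp.l1_mapDomain_le _ z
    have a₂ : (T.ancLin (n + 1) z).l1 ≤ z.l1 := Finsupp.l1_mapDomain_le _ z
    nlinarith [mul_le_mul_of_nonneg_left a₁ (sub_nonneg.2 h₁), mul_le_mul_of_nonneg_left a₂ h₀]

/-- Truncation of points at level `r`: for natural `r` the retraction to the ball of radius `r`,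
and the linear interpolation of these in between. -/
noncomputable def trunc (r : ℝ) (x : T.Space) : T.Space :=
  (T.truncLin ⌊r⌋₊ (Int.fract r) (Int.fract_nonneg r) (Int.fract_lt_one r).le).toMap x

/-- The endpoint `s = 1` is included: there the floor jumps to `n + 1`, but the formulas of the two
adjacent unit intervals agree. -/
lemma trunc_val {n : ℕ} {s : ℝ} (h₀ : 0 ≤ s) (h₁ : s ≤ 1) (x : T.Space) :
    (trunc (n + s) x).1 = (1 - s) • T.ancLin n x.1 + s • T.ancLin (n + 1) x.1 := by
  rcases h₁.eq_or_lt with rfl | h₁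
  · have h : ⌊(n : ℝ) + 1⌋₊ = n + 1 := by exact_mod_cast Nat.floor_natCast (R := ℝ) (n + 1)
    have h' : Int.fract ((n : ℝ) + 1) = 0 := by simp
    simp [trunc, LinearEdgeMap.toMap, truncLin, h, h']
  · have h : ⌊(n : ℝ) + s⌋₊ = n := by
      rw [Nat.floor_eq_iff (by positivity)]; constructor <;> linarith
    have h' : Int.fract ((n : ℝ) + s) = s := by simp [Int.fract_eq_self, h₀, h₁]
    simp only [trunc, LinearEdgeMap.toMap, truncLin, h, h']
    rfl

lemma trunc_natCast_val (n : ℕ) (x : T.Space) : (trunc n x).1 = T.ancLin n x.1 := by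
  have := trunc_val (n := n) le_rfl zero_le_one x
  simpa using this

lemma exists_nat_add {r : ℝ} (hr : 0 ≤ r) : ∃ (n : ℕ) (s : ℝ), 0 ≤ s ∧ s < 1 ∧ r = n + s :=
  ⟨⌊r⌋₊, r - ⌊r⌋₊, sub_nonneg.2 (Nat.floor_le hr), by linarith [Nat.lt_floor_add_one r], by ring⟩

lemma dist_trunc_trunc_le (r : ℝ) (x y : T.Space) : dist (trunc r x) (trunc r y) ≤ dist x y :=
  dist_toMap_le _ x y

lemma trunc_natCast_pt (n : ℕ) (a : T.V) : trunc n (T.pt a) = T.pt (T.anc n a) :=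
  Subtype.ext (by rw [trunc_natCast_val, pt_val, pt_val, ancLin_single])

lemma onCommonEdge_trunc (n : ℕ) {s t : ℝ} (hs₀ : 0 ≤ s) (hs₁ : s ≤ 1) (ht₀ : 0 ≤ t) (ht₁ : t ≤ 1)
    (x : T.Space) :
    OnCommonEdge (G := T.graph) (trunc (n + s) x) (trunc (n + t) x) := by
  obtain ⟨a, b, hab, hx⟩ := x.2
  obtain ⟨u, hu₀, hu₁, e⟩ := mem_realEdge_iff.1 hx
  obtain ⟨c, d, hcd, h₁, h₂, h₃, h₄⟩ := T.exists_edge_anc n hab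
  have key : ∀ v, (v = c ∨ v = d) → Finsupp.single v (1 : ℝ) ∈ realEdge c d := by
    rintro v (rfl | rfl)
    · exact single_left_mem_realEdge _ _
    · exact single_right_mem_realEdge _ _
  have m₁ : T.ancLin n x.1 ∈ realEdge c d := by
    rw [e, map_add, map_smul, map_smul, ancLin_single, ancLin_single]
    exact convex_realEdge c d (key _ h₁) (key _ h₂) (sub_nonneg.2 hu₁) hu₀ (by ring)
  have m₂ : T.ancLin (n + 1) x.1 ∈ realEdge c d := by
    rw [e, map_add, map_smul, map_smul, ancLin_single, ancLin_single]
    exact convex_realEdge c d (key _ h₃) (key _ h₄) (sub_nonneg.2 hu₁) hu₀ (by ring)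
  refine ⟨c, d, hcd, ?_, ?_⟩
  · rw [trunc_val hs₀ hs₁]
    exact convex_realEdge c d m₁ m₂ (sub_nonneg.2 hs₁) hs₀ (by ring)
  · rw [trunc_val ht₀ ht₁]
    exact convex_realEdge c d m₁ m₂ (sub_nonneg.2 ht₁) ht₀ (by ring)

/-- Within a unit interval of levels the truncations move linearly along one edge. Their velocity is
a difference of two vectors of norm at most `1`, and the factor `1 / 2` in the edge length cancels
the resulting `2`. -/
lemma dist_trunc_le_of_same_unit (n : ℕ) {s t : ℝ} (hs₀ : 0 ≤ s) (hst : s ≤ t) (ht₁ : t ≤ 1)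
    (x : T.Space) : dist (trunc (n + s) x) (trunc (n + t) x) ≤ t - s := by
  refine (dist_le_edgeLength
    (onCommonEdge_trunc n hs₀ (hst.trans ht₁) (hs₀.trans hst) ht₁ x)).trans ?_
  have e : (trunc (n + s) x).1 - (trunc (n + t) x).1 =
      (t - s) • (T.ancLin n x.1 - T.ancLin (n + 1) x.1) := by
    rw [trunc_val hs₀ (hst.trans ht₁), trunc_val (hs₀.trans hst) ht₁]
    module
  have h₁ : (T.ancLin n x.1).l1 ≤ 1 := (Finsupp.l1_mapDomain_le _ _).trans (l1_le_one x)
  have h₂ : (T.ancLin (n + 1) x.1).l1 ≤ 1 := (Finsupp.l1_mapDomain_le _ _).trans (l1_le_one x)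
  have h₃ := Finsupp.l1_sub_le (T.ancLin n x.1) (T.ancLin (n + 1) x.1)
  change 1 / 2 * Finsupp.l1 (_ - _) ≤ _
  rw [e, Finsupp.l1_smul, abs_of_nonneg (sub_nonneg.2 hst)]
  have := mul_le_mul_of_nonneg_left (h₃.trans (add_le_add h₁ h₂)) (sub_nonneg.2 hst)
  linarith

lemma dist_trunc_le_of_le {r r' : ℝ} (hr : 0 ≤ r) (hrr' : r ≤ r') (x : T.Space) :
    dist (trunc r x) (trunc r' x) ≤ r' - r := by
  obtain ⟨n, s, hs₀, hs₁, rfl⟩ := exists_nat_add hr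
  -- Induction on the number of integer levels between `r` and `r'`.
  have key : ∀ (k : ℕ) (r' : ℝ), n + s ≤ r' → r' ≤ n + k + 1 →
      dist (trunc (n + s) x) (trunc r' x) ≤ r' - (n + s) := by
    intro k
    induction k with
    | zero =>
      intro r' h₁ h₂
      have := dist_trunc_le_of_same_unit n hs₀ (t := r' - n) (by linarith)
        (by push_cast at h₂; linarith) x
      rw [add_sub_cancel] at this
      linarith
    | succ k ih =>
      intro r' h₁ h₂
      by_cases h : r' ≤ n + k + 1
      · exact ih r' h₁ h
      push Not at h
      have a := ih (n + k + 1) (by have := k.cast_nonneg (α := ℝ); linarith) le_rfl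
      have b := dist_trunc_le_of_same_unit (n + k + 1) le_rfl (t := r' - (n + k + 1)) (by linarith)
        (by push_cast at h₂; linarith) x
      push_cast at b
      rw [add_zero, add_sub_cancel] at b
      have := dist_triangle (trunc (n + s) x) (trunc ((n : ℝ) + k + 1) x) (trunc r' x)
      linarith
  obtain ⟨k, hk⟩ := exists_nat_ge r'
  exact key k r' hrr' (by have := n.cast_nonneg (α := ℝ); linarith)

lemma dist_trunc_le {r r' : ℝ} (hr : 0 ≤ r) (hr' : 0 ≤ r') (x y : T.Space) :
    dist (trunc r x) (trunc r' y) ≤ dist x y + |r - r'| := by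
  have h₁ := dist_trunc_trunc_le r x y
  have h₂ : dist (trunc r y) (trunc r' y) ≤ |r - r'| := by
    rcases le_total r r' with h | h
    · rw [abs_sub_comm, abs_of_nonneg (sub_nonneg.2 h)]
      exact dist_trunc_le_of_le hr h y
    · rw [abs_of_nonneg (sub_nonneg.2 h), dist_comm]
      exact dist_trunc_le_of_le hr' h y
  exact (dist_triangle _ _ _).trans (add_le_add h₁ h₂)

lemma ancLin_of_ht_le {n : ℕ} {x : T.Space} (h : ht x ≤ n) : T.ancLin n x.1 = x.1 := by
  rcases exists_eq_par_of_pos x with ⟨a, rfl⟩ | ⟨b, s, h₀, h₁, hd, e⟩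
  · rw [ht_pt] at h
    rw [pt_val, ancLin_single, T.anc_of_depth_le (by exact_mod_cast h)]
  · have hb : T.depth b ≤ n := by
      rw [ht_of_eq e, hd] at h
      rw [hd, Nat.succ_le_iff]
      -- Positivity of `s` makes this strict, so the integer depth of `b` is still at most `n`.
      have : (T.depth (T.par b) : ℝ) < n := by push_cast at h; linarith
      exact_mod_cast this
    rw [e, map_add, map_smul, map_smul, ancLin_single, ancLin_single, T.anc_of_depth_le hb,
      T.anc_of_depth_le (by omega)]

/-- The slack `1` forces the integer part of `r` to be at least `ht x`. Without it the interpolation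
can move `x`, for instance at `r = ht x` in the interior of an edge. -/
lemma trunc_of_ht_add_one_le {r : ℝ} {x : T.Space} (h : ht x + 1 ≤ r) : trunc r x = x := by
  obtain ⟨n, s, h₀, h₁, rfl⟩ := exists_nat_add (by linarith [ht_nonneg x] : 0 ≤ r)
  refine Subtype.ext ?_
  rw [trunc_val h₀ h₁.le, ancLin_of_ht_le (by linarith), ancLin_of_ht_le (by push_cast; linarith),
    ← add_smul]
  simp

lemma trunc_zero (x : T.Space) : trunc 0 x = T.base := by
  have := trunc_natCast_val 0 x
  rw [Nat.cast_zero] at this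
  refine Subtype.ext (this.trans ?_)
  obtain ⟨b, s, h₀, h₁, e⟩ := exists_eq_par x
  rw [e, map_add, map_smul, map_smul, ancLin_single, ancLin_single, anc_zero, anc_zero, ← add_smul,
    ← pt_root, pt_val]
  simp

lemma trunc_base {r : ℝ} (hr : 0 ≤ r) : trunc r T.base = T.base := by
  obtain ⟨n, s, h₀, h₁, rfl⟩ := exists_nat_add hr
  refine Subtype.ext ?_
  rw [trunc_val h₀ h₁.le, ← pt_root, pt_val, ancLin_single, ancLin_single,
    T.anc_of_depth_le (by simp), T.anc_of_depth_le (by simp), ← add_smul]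
  simp

/-- The path `r ↦ trunc r x` runs from the root to `x` with speed at most `1`. -/
lemma dist_base_le (x : T.Space) : dist x T.base ≤ ht x + 1 := by
  have := dist_trunc_le_of_le le_rfl (by linarith [ht_nonneg x] : 0 ≤ ht x + 1) x
  rw [trunc_zero, trunc_of_ht_add_one_le le_rfl, dist_comm] at this
  linarith

lemma exists_trunc_eq_pt {n : ℕ} {x : T.Space} (h : n ≤ ht x) :
    ∃ a, T.depth a = n ∧ trunc n x = T.pt a := by
  rcases exists_eq_par_of_pos x with ⟨a, rfl⟩ | ⟨b, s, h₀, h₁, hd, e⟩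
  · refine ⟨T.anc n a, ?_, trunc_natCast_pt n a⟩
    rw [ht_pt] at h
    rw [depth_anc, min_eq_left (by exact_mod_cast h)]
  · have hb : n ≤ T.depth b := by
      rw [ht_of_eq e, hd] at h
      have : (n : ℝ) ≤ T.depth b := by rw [hd]; push_cast at h ⊢; linarith
      exact_mod_cast this
    rcases hb.lt_or_eq with hb' | rfl
    · refine ⟨T.anc n b, by rw [depth_anc, min_eq_left hb], Subtype.ext ?_⟩
      rw [trunc_natCast_val, e, map_add, map_smul, map_smul, ancLin_single, ancLin_single,
        T.anc_par hb', ← add_smul, pt_val]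
      simp
    -- If the upper end `b` has depth exactly `n`, then height at least `n` forces `x` to be `b`.
    · have hs : s = 1 := by
        rw [ht_of_eq e, hd] at h
        push_cast at h
        linarith
      subst hs
      refine ⟨b, rfl, Subtype.ext ?_⟩
      rw [trunc_natCast_val, e, sub_self, zero_smul, one_smul, zero_add, ancLin_single,
        T.anc_of_depth_le le_rfl, pt_val]

/-- Truncation at an integer `k ≤ n` factors through truncation at `n`, and real levels interpolate
integer ones. -/
lemma trunc_congr {n : ℕ} {x y : T.Space} (h : trunc n x = trunc n y) {r : ℝ} (hr₀ : 0 ≤ r)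
    (hr : r ≤ n) : trunc r x = trunc r y := by
  have key : ∀ k ≤ n, T.ancLin k x.1 = T.ancLin k y.1 := by
    intro k hk
    have e : T.ancLin n x.1 = T.ancLin n y.1 := by
      rw [← trunc_natCast_val, h, trunc_natCast_val]
    have := congrArg (T.ancLin k) e
    rwa [ancLin_ancLin, ancLin_ancLin, min_eq_left hk] at this
  obtain ⟨k, s, h₀, h₁, rfl⟩ := exists_nat_add hr₀
  refine Subtype.ext ?_
  rw [trunc_val h₀ h₁.le, trunc_val h₀ h₁.le]
  have hk : k ≤ n := by
    have : (k : ℝ) ≤ n := by linarith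
    exact_mod_cast this
  rcases hk.eq_or_lt with rfl | hk'
  · have : s = 0 := by linarith
    rw [this, key k hk]; simp
  · rw [key k hk, key (k + 1) hk']

lemma trunc_trunc (n m : ℕ) (x : T.Space) : trunc n (trunc m x) = trunc (min n m : ℕ) x :=
  Subtype.ext (by rw [trunc_natCast_val, trunc_natCast_val, trunc_natCast_val, ancLin_ancLin])

/-- At an integer level `k ≥ n` the truncation is `x` itself or a vertex of depth `k`. Height is
affine along the interpolation. -/
lemma le_ht_trunc {n : ℕ} {x : T.Space} (h : n ≤ ht x) {r : ℝ} (hr : n ≤ r) :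
    n ≤ ht (trunc r x) := by
  have key : ∀ k : ℕ, n ≤ k → (n : ℝ) ≤ ht (trunc k x) := by
    intro k hk
    rcases le_total (k : ℝ) (ht x) with h' | h'
    · obtain ⟨a, ha, e⟩ := exists_trunc_eq_pt h'
      rw [e, ht_pt, ha]
      exact_mod_cast hk
    · have : trunc k x = x := Subtype.ext (by rw [trunc_natCast_val, ancLin_of_ht_le h'])
      rwa [this]
  obtain ⟨k, s, h₀, h₁, rfl⟩ := exists_nat_add (n.cast_nonneg.trans hr)
  have hk : n ≤ k := by
    have : (n : ℝ) < k + 1 := by linarith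
    exact Nat.lt_succ_iff.1 (by exact_mod_cast this)
  have e : ht (trunc (k + s) x) = (1 - s) * ht (trunc k x) + s * ht (trunc (k + 1 : ℕ) x) := by
    simp only [ht, trunc_natCast_val, trunc_val h₀ h₁.le, map_add, map_smul, smul_eq_mul]
  rw [e]
  have a := mul_le_mul_of_nonneg_left (key k hk) (sub_nonneg.2 h₁.le)
  have b := mul_le_mul_of_nonneg_left (key (k + 1) (by omega)) h₀
  linarith

/-- Truncation at `n` is continuous and, at these heights, takes values in the uniformly separated
set of vertices. -/
lemma trunc_eq_of_preconnectedSpace {I : Type*} [TopologicalSpace I] [PreconnectedSpace I]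
    {γ : I → T.Space} (hγ : Continuous γ) {n : ℕ} (h : ∀ i, n ≤ ht (γ i)) (i j : I) :
    trunc n (γ i) = trunc n (γ j) := by
  have hloc : IsLocallyConstant fun i => trunc n (γ i) := by
    rw [IsLocallyConstant.iff_eventually_eq]
    intro i
    filter_upwards [hγ.continuousAt.eventually (Metric.ball_mem_nhds (γ i) one_half_pos)] with j hj
    obtain ⟨a, -, ha⟩ := exists_trunc_eq_pt (h i)
    obtain ⟨b, -, hb⟩ := exists_trunc_eq_pt (h j)
    have := (dist_trunc_trunc_le n (γ j) (γ i)).trans_lt hj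
    rw [ha, hb] at this ⊢
    rw [eq_of_dist_pt_lt this]
  exact hloc.apply_eq_of_preconnectedSpace i j

lemma continuous_trunc {I : Type*} [TopologicalSpace I] {r : I → ℝ} {γ : I → T.Space}
    (hr : Continuous r) (hγ : Continuous γ) (h₀ : ∀ i, 0 ≤ r i) :
    Continuous fun i => trunc (r i) (γ i) := by
  rw [continuous_iff_continuousAt]
  intro i
  rw [ContinuousAt, tendsto_iff_dist_tendsto_zero]
  have h₁ : Filter.Tendsto (fun j => dist (γ j) (γ i) + |r j - r i|) (nhds i) (nhds 0) := by
    have : Continuous fun j => dist (γ j) (γ i) + |r j - r i| := by fun_prop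
    simpa using this.tendsto i
  exact squeeze_zero (fun _ => dist_nonneg) (fun j => dist_trunc_le (h₀ j) (h₀ i) _ _) h₁

/-- A continuous map sending high points to high points commutes with truncation in the range,
up to truncation in the source. -/
lemma trunc_map_trunc {f : S.Space → T.Space} (hf : Continuous f) {n N : ℕ}
    (h : ∀ x, N ≤ ht x → n ≤ ht (f x)) {x : S.Space} (hx : N ≤ ht x) :
    trunc n (f (trunc N x)) = trunc n (f x) := by
  -- The truncations of `x` at levels from `N` upwards form a path from `trunc N x` to `x` at height
  -- at least `N`.
  have hc : Continuous fun r : Set.Ici (N : ℝ) => f (trunc (r : ℝ) x) :=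
    hf.comp (continuous_trunc continuous_subtype_val continuous_const
      fun r => N.cast_nonneg.trans r.2)
  have : PreconnectedSpace (Set.Ici (N : ℝ)) :=
    Subtype.preconnectedSpace (convex_Ici (N : ℝ)).isPreconnected
  have := trunc_eq_of_preconnectedSpace hc (n := n) (fun r => h _ (le_ht_trunc hx r.2))
    ⟨N, Set.mem_Ici.2 le_rfl⟩ ⟨ht x + 1, Set.mem_Ici.2 (by linarith)⟩
  simpa only [trunc_of_ht_add_one_le (le_refl (ht x + 1))] using this

end RootedSimplicialTree

/-! ### Height criteria, levels, and the morphism represented by a map -/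

namespace RootedSimplicialTree

variable {S T U : RootedSimplicialTree.{u}}

/-- Height and distance to the root bound each other linearly, so properness can be tested on
heights alone. -/
lemma isBounded_iff_ht {A : Set T.Space} :
    Bornology.IsBounded A ↔ ∃ C : ℝ, ∀ x ∈ A, ht x ≤ C := by
  rw [Metric.isBounded_iff_subset_closedBall T.base]
  constructor
  · rintro ⟨r, h⟩
    exact ⟨2 * r, fun x hx => (ht_le_dist x).trans
      (mul_le_mul_of_nonneg_left (Metric.mem_closedBall.1 (h hx)) zero_le_two)⟩
  · rintro ⟨C, h⟩
    exact ⟨C + 1, fun x hx => Metric.mem_closedBall.2 ((dist_base_le x).trans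
      (by linarith [h x hx]))⟩

lemma metricallyProper_iff_ht {f : S.Space → T.Space} :
    MetricallyProper f ↔ ∀ n : ℕ, ∃ N : ℕ, ∀ x, N ≤ ht x → n ≤ ht (f x) := by
  constructor
  · intro h n
    obtain ⟨C, hC⟩ := isBounded_iff_ht.1 (h {y | ht y ≤ n} (isBounded_iff_ht.2 ⟨n, fun x hx => hx⟩))
    obtain ⟨N, hN⟩ := exists_nat_gt C
    refine ⟨N, fun x hx => ?_⟩
    by_contra hn
    have := hC x (not_le.1 hn).le
    linarith
  · intro h A hA
    obtain ⟨C, hC⟩ := isBounded_iff_ht.1 hA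
    obtain ⟨n, hn⟩ := exists_nat_gt C
    obtain ⟨N, hN⟩ := h n
    refine isBounded_iff_ht.2 ⟨N, fun x hx => ?_⟩
    by_contra hx'
    have := hC _ hx
    have := hN x (not_le.1 hx').le
    linarith

lemma properHomotopy_iff_ht {I : Type*} {H : I → S.Space → T.Space} :
    (∀ M > 0, ∃ N > 0, ∀ i x, H i x ∈ Metric.ball T.base M → x ∈ Metric.ball S.base N) ↔
      ∀ n : ℕ, ∃ N : ℕ, ∀ i x, N ≤ ht x → n ≤ ht (H i x) := by
  constructor
  · intro h n
    obtain ⟨C, -, hC⟩ := h (n + 2) (by positivity)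
    obtain ⟨N, hN⟩ := exists_nat_gt (2 * C)
    refine ⟨N, fun i x hx => ?_⟩
    by_contra hn
    have h₁ := hC i x (Metric.mem_ball.2 ((dist_base_le _).trans_lt (by linarith)))
    have h₂ := ht_le_dist x
    have := Metric.mem_ball.1 h₁
    linarith
  · intro h M _
    obtain ⟨n, hn⟩ := exists_nat_gt (2 * M)
    obtain ⟨N, hN⟩ := h n
    refine ⟨N + 2, by positivity, fun i x hx => ?_⟩
    refine Metric.mem_ball.2 ((dist_base_le _).trans_lt ?_)
    by_contra hx'
    have h₁ := hN i x (by linarith)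
    have h₂ := ht_le_dist (H i x)
    have := Metric.mem_ball.1 hx
    linarith

lemma exists_le_ht (f : RootedCoarseMap S T) (n : ℕ) :
    ∃ N : ℕ, ∀ x, N ≤ ht x → n ≤ ht (f.map x) :=
  metricallyProper_iff_ht.1 f.coarse.proper n

variable (T) in
/-- The inverse sequence of the sets of vertices at depth `n`. -/
noncomputable def levels : InverseSequence (Type u) where
  sys :=
    { obj := fun n => {v : T.V // T.depth v = n.unop}
      map := fun {m n} h => TypeCat.ofHom fun v => ⟨T.anc n.unop v.1, by
        have : n.unop ≤ m.unop := leOfHom h.unop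
        rw [depth_anc, v.2, min_eq_left this]⟩
      map_id := fun n => by
        ext v
        exact T.anc_of_depth_le v.2.le
      map_comp := fun {m n k} h h' => by
        ext v
        have : k.unop ≤ n.unop := leOfHom h'.unop
        change T.anc k.unop v.1 = T.anc k.unop (T.anc n.unop v.1)
        rw [anc_anc, min_eq_left this] }

lemma levels_bond_val {n m : ℕ} (h : n ≤ m) (v : T.levels.term m) :
    (T.levels.bond h v).1 = T.anc n v.1 := rfl

lemma levels_ext {n : ℕ} {v w : T.levels.term n} (h : v.1 = w.1) : v = w := Subtype.ext h

lemma trunc_eq_pt_bond {n m : ℕ} (h : n ≤ m) {x : T.Space} {v : T.levels.term m}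
    (hv : trunc m x = T.pt v.1) : trunc n x = T.pt (T.levels.bond h v).1 := by
  rw [levels_bond_val, ← trunc_natCast_pt, ← hv, trunc_trunc, min_eq_left h]

lemma exists_level {n : ℕ} {x : T.Space} (h : n ≤ ht x) :
    ∃ v : T.levels.term n, trunc n x = T.pt v.1 := by
  obtain ⟨a, ha, e⟩ := exists_trunc_eq_pt h
  exact ⟨⟨a, ha⟩, e⟩

lemma ht_level {n : ℕ} (v : T.levels.term n) : ht (T.pt v.1) = n := by
  rw [ht_pt]; exact congrArg Nat.cast v.2

lemma trunc_level {n : ℕ} (v : T.levels.term n) : trunc n (T.pt v.1) = T.pt v.1 := by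
  rw [trunc_natCast_pt, T.anc_of_depth_le (le_of_eq v.2)]

open InverseSequence

/-- The morphism `s` of inverse sequences describes what `f` does on levels far from the root. -/
def Represents (f : S.Space → T.Space) (s : SeqHom S.levels T.levels) : Prop :=
  ∀ n, ∃ N, s.index n ≤ N ∧ ∀ x, (N : ℝ) ≤ ht x → ∀ a : S.levels.term (s.index n),
    trunc (s.index n) x = S.pt a.1 → trunc n (f x) = T.pt (s.app n a).1

lemma represents_id : Represents (fun x : T.Space => x) (SeqHom.id T.levels) :=
  fun n => ⟨n, le_rfl, fun _ _ _ h => h⟩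

/-- Properness of `f` carries far points into the region where `t` describes `g`. -/
lemma Represents.comp {f : RootedCoarseMap S T} {g : RootedCoarseMap T U}
    {s : SeqHom S.levels T.levels} {t : SeqHom T.levels U.levels} (hs : Represents f.map s)
    (ht : Represents g.map t) : Represents (fun x => g.map (f.map x)) (s.comp t) := by
  intro n
  obtain ⟨N, -, hN⟩ := ht n
  obtain ⟨M, hM, hM'⟩ := hs (t.index n)
  obtain ⟨P, hP⟩ := exists_le_ht f N
  refine ⟨max M P, hM.trans (le_max_left _ _), fun x hx a ha => ?_⟩
  rw [Nat.cast_max, max_le_iff] at hx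
  exact hN _ (hP x hx.2) _ (hM' x hx.1 a ha)

/-- On a vertex far enough out, the truncated value of `f` determines both components. -/
lemma Represents.equivRel {f : S.Space → T.Space} {s t : SeqHom S.levels T.levels}
    (hs : Represents f s) (ht : Represents f t) : equivRel s t := by
  intro n
  obtain ⟨N, h₁, hN⟩ := hs n
  obtain ⟨M, h₂, hM⟩ := ht n
  refine ⟨max N M, h₁.trans (le_max_left _ _), h₂.trans (le_max_right _ _), ?_⟩
  ext v
  refine levels_ext (pt_injective ?_)
  have hv := ht_level v
  have e₁ := hN (S.pt v.1) (by rw [hv]; exact_mod_cast le_max_left _ _) _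
    (trunc_eq_pt_bond (h₁.trans (le_max_left _ _)) (trunc_level v))
  have e₂ := hM (S.pt v.1) (by rw [hv]; exact_mod_cast le_max_right _ _) _
    (trunc_eq_pt_bond (h₂.trans (le_max_right _ _)) (trunc_level v))
  exact e₁.symm.trans e₂

lemma Represents.of_equivRel {f : S.Space → T.Space} {s t : SeqHom S.levels T.levels}
    (hs : Represents f s) (h : InverseSequence.equivRel s t) : Represents f t := by
  intro n
  obtain ⟨N, -, hN⟩ := hs n
  obtain ⟨m, h₁, h₂, e⟩ := h n
  refine ⟨max N m, h₂.trans (le_max_right _ _), fun x hx a ha => ?_⟩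
  rw [Nat.cast_max, max_le_iff] at hx
  -- The components of `s` and `t` agree on the ancestor of `x` at level `m`.
  obtain ⟨v, hv⟩ := exists_level hx.2
  rw [hN x hx.1 _ (trunc_eq_pt_bond h₁ hv)]
  have e' : s.app n (S.levels.bond h₁ v) = t.app n (S.levels.bond h₂ v) :=
    congrArg (fun φ : S.levels.term m ⟶ T.levels.term n => φ v) e
  rw [e']
  congr 3
  exact levels_ext (pt_injective ((trunc_eq_pt_bond h₂ hv).symm.trans ha))

/-- The index function is a properness modulus of `f`; the components are the truncated values of
`f` on vertices of those levels. -/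
lemma exists_represents (f : RootedCoarseMap S T) : ∃ s, Represents f.map s := by
  choose N hN using exists_le_ht f
  have hf := f.map.continuous
  have hA : ∀ n (v : S.levels.term (N n)), ∃ w : T.levels.term n,
      trunc n (f.map (S.pt v.1)) = T.pt w.1 := fun n v =>
    exists_level (hN n _ (ht_level v).ge)
  choose A hA using hA
  have key : ∀ n x, (N n : ℝ) ≤ ht x → ∀ a : S.levels.term (N n), trunc (N n) x = S.pt a.1 →
      trunc n (f.map x) = T.pt (A n a).1 := by
    intro n x hx a ha
    rw [← hA, ← ha, trunc_map_trunc hf (hN n) hx]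
  refine ⟨⟨N, fun n => TypeCat.ofHom (A n), fun n n' h =>
    ⟨max (N n) (N n'), le_max_left _ _, le_max_right _ _, ?_⟩⟩, fun n => ⟨N n, le_rfl, key n⟩⟩
  ext v
  refine levels_ext (pt_injective ?_)
  have hv := ht_level v
  have e₁ := key n (S.pt v.1) (by rw [hv]; exact_mod_cast le_max_left _ _) _
    (trunc_eq_pt_bond (le_max_left _ _) (trunc_level v))
  have e₂ := key n' (S.pt v.1) (by rw [hv]; exact_mod_cast le_max_right _ _) _
    (trunc_eq_pt_bond (le_max_right _ _) (trunc_level v))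
  exact e₁.symm.trans (trunc_eq_pt_bond h e₂)

/-- The track of a far point under a proper homotopy stays high, so its truncation is constant in
time. -/
lemma Represents.of_homotopic {f g : RootedCoarseMap S T} (h : rootedCoarseHomotopic f g)
    {s : SeqHom S.levels T.levels} (hs : Represents f.map s) : Represents g.map s := by
  obtain ⟨H, -, hH, -⟩ := h
  have hH' := (properHomotopy_iff_ht (H := fun t x => H (t, x))).1 hH
  intro n
  obtain ⟨N, h₁, hN⟩ := hs n
  obtain ⟨M, hM⟩ := hH' n
  refine ⟨max N M, h₁.trans (le_max_left _ _), fun x hx a ha => ?_⟩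
  rw [Nat.cast_max, max_le_iff] at hx
  rw [← hN x hx.1 a ha]
  have hc : Continuous fun t : unitInterval => H (t, x) := by fun_prop
  have := trunc_eq_of_preconnectedSpace hc (fun t => hM t x hx.2) 1 0
  simpa using this

/-- To represent a map, it suffices to represent it on vertices. -/
lemma Represents.of_vertices {f : RootedCoarseMap S T} {s : SeqHom S.levels T.levels}
    (h : ∀ n, ∃ N, s.index n ≤ N ∧ ∀ v : S.V, N ≤ S.depth v → ∀ a : S.levels.term (s.index n),
      S.anc (s.index n) v = a.1 → trunc n (f.map (S.pt v)) = T.pt (s.app n a).1) :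
    Represents f.map s := by
  intro n
  obtain ⟨N, h₁, hN⟩ := h n
  obtain ⟨M, hM⟩ := exists_le_ht f n
  have hl : N ≤ max N M := le_max_left _ _
  refine ⟨max N M, h₁.trans hl, fun x hx a ha => ?_⟩
  obtain ⟨v, hv⟩ := exists_level hx
  -- Replacing `x` by its truncation at `max N M`, which is a vertex, does not change the truncated
  -- value of `f`.
  rw [← trunc_map_trunc f.map.continuous (fun y hy => hM y (le_trans
    (by exact_mod_cast le_max_right _ _) hy)) hx, hv]
  refine hN v.1 (hl.trans (ge_of_eq v.2)) a (pt_injective ?_)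
  rw [← ha, trunc_eq_pt_bond (h₁.trans hl) hv, levels_bond_val]

end RootedSimplicialTree

/-! ### Slow truncation levels and faithfulness -/

lemma exists_strictMono_ge (N : ℕ → ℕ) :
    ∃ M : ℕ → ℕ, StrictMono M ∧ M 0 = 0 ∧ ∀ n, n ≠ 0 → N n ≤ M n := by
  refine ⟨fun n => ∑ i ∈ Finset.range n, (N (i + 1) + 1), strictMono_nat_of_lt_succ fun n => ?_,
    by simp, fun n hn => ?_⟩
  · rw [Finset.sum_range_succ]; omega
  · obtain ⟨k, rfl⟩ := Nat.exists_eq_succ_of_ne_zero hn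
    simp only [Finset.sum_range_succ, Nat.succ_eq_add_one]; omega

/-- A proper `1`-Lipschitz function growing as slowly as desired. -/
lemma exists_slow_function (N : ℕ → ℕ) (hN : StrictMono N) : ∃ κ : ℝ → ℝ, (∀ h, 0 ≤ κ h) ∧
    (∀ h h', |κ h - κ h'| ≤ |h - h'|) ∧ (∀ h : ℝ, ∃ n : ℕ, (n = 0 ∨ N n ≤ h) ∧ κ h ≤ n) ∧
    ∀ n : ℕ, ∃ M : ℕ, ∀ h : ℝ, M ≤ h → n ≤ κ h := by
  -- `κ` will be the infimum of these functions. Each is `1`-Lipschitz, hence so is the infimum, and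
  -- the `n`-th stays at `n` up to height `N (n + 1)`, which keeps `κ` slow.
  set a : ℕ → ℝ → ℝ := fun n h => n + max 0 (h - N (n + 1)) with ha
  have a_nonneg : ∀ n h, 0 ≤ a n h := fun n h => by positivity
  have bdd : ∀ h, BddBelow (Set.range fun n => a n h) := fun h => ⟨0, by
    rintro _ ⟨n, rfl⟩; exact a_nonneg n h⟩
  have lip : ∀ h h', (⨅ n, a n h) - |h - h'| ≤ ⨅ n, a n h' := fun h h' => by
    refine le_ciInf fun n => ?_
    have h₁ := ciInf_le (bdd h) n
    have h₂ := abs_max_sub_max_le_abs (h - N (n + 1)) (h' - N (n + 1)) 0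
    rw [sub_sub_sub_cancel_right, max_comm, max_comm _ (0 : ℝ)] at h₂
    have h₃ := le_abs_self (max 0 (h - N (n + 1)) - max 0 (h' - N (n + 1)))
    simp only [ha] at h₁ ⊢
    linarith
  refine ⟨fun h => ⨅ n, a n h, fun h => Real.iInf_nonneg fun n => a_nonneg n h, fun h h' => ?_,
    fun h => ?_, fun n => ⟨N n + n, fun h hh => le_ciInf fun j => ?_⟩⟩
  · have h₁ := lip h h'
    have h₂ := lip h' h
    rw [abs_sub_comm] at h₂
    rw [abs_le]; constructor <;> linarith
  · have hex : ∃ n, h < N (n + 1) := by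
      obtain ⟨n, hn⟩ := exists_nat_gt h
      refine ⟨n, hn.trans_le ?_⟩
      exact_mod_cast (hN.le_apply (x := n)).trans (hN.monotone n.le_succ)
    classical
    -- For the least `n` with `h < N (n + 1)` the `n`-th function equals `n` at `h`, and minimality
    -- gives `N n ≤ h` unless `n = 0`.
    refine ⟨Nat.find hex, ?_, (ciInf_le (bdd h) (Nat.find hex)).trans ?_⟩
    · rcases Nat.eq_zero_or_eq_succ_pred (Nat.find hex) with h₀ | h₀
      · exact Or.inl h₀
      · have := Nat.find_min hex (m := (Nat.find hex).pred) (by omega)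
        rw [not_lt, ← Nat.succ_eq_add_one, ← h₀] at this
        exact Or.inr this
    · have := Nat.find_spec hex
      simp only [ha]
      rw [max_eq_left (by linarith)]
      simp
  · push_cast at hh
    simp only [ha]
    -- For `j < n` the ramp of the `j`-th function starts no later than `N n`, so it has risen by
    -- `n` at height `N n + n`.
    rcases le_or_gt n j with hj | hj
    · have : (n : ℝ) ≤ j := by exact_mod_cast hj
      linarith [le_max_left 0 (h - N (j + 1))]
    · have : (N (j + 1) : ℝ) ≤ N n := by exact_mod_cast hN.monotone hj
      linarith [le_max_right 0 (h - N (j + 1)), j.cast_nonneg (α := ℝ)]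

namespace RootedSimplicialTree

variable {S T : RootedSimplicialTree.{u}}

lemma isCoarseMap_trunc (f : RootedCoarseMap S T) {r : S.Space → ℝ} (h₀ : ∀ x, 0 ≤ r x)
    (hb : ∀ R > 0, ∃ Q > 0, ∀ x y, dist x y < R → |r x - r y| < Q)
    (hp : ∀ n : ℕ, ∃ N : ℕ, ∀ x, N ≤ ht x → n ≤ r x) :
    IsCoarseMap fun x => trunc (r x) (f.map x) := by
  refine ⟨metricallyProper_iff_ht.2 fun n => ?_, fun R hR => ?_⟩
  · obtain ⟨N, hN⟩ := hp n
    obtain ⟨M, hM⟩ := exists_le_ht f n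
    refine ⟨max N M, fun x hx => ?_⟩
    rw [Nat.cast_max, max_le_iff] at hx
    exact le_ht_trunc (hM x hx.2) (hN x hx.1)
  · obtain ⟨Q, hQ, h⟩ := hb R hR
    obtain ⟨P, hP, h'⟩ := f.coarse.bornologous R hR
    exact ⟨P + Q, by positivity, fun x y hxy => (dist_trunc_le (h₀ x) (h₀ y) _ _).trans_lt
      (add_lt_add (h' x y hxy) (h x y hxy))⟩

/-- The level at time `t` of the homotopy from a map `f` to its truncation at the level `κ`. -/
noncomputable def interpLevel (f : RootedCoarseMap S T) (κ : ℝ → ℝ) (t : ℝ) (x : S.Space) : ℝ :=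
  (1 - t) * (ht (f.map x) + 1) + t * κ (ht x)

lemma interpLevel_nonneg (f : RootedCoarseMap S T) {κ : ℝ → ℝ} (κ_nonneg : ∀ h, 0 ≤ κ h)
    (t : unitInterval) (x : S.Space) : 0 ≤ interpLevel f κ t x := by
  have h₁ := κ_nonneg (ht x)
  have h₂ := ht_nonneg (f.map x)
  have h₃ := sub_nonneg.2 t.2.2
  have h₄ := t.2.1
  unfold interpLevel
  positivity

lemma interpLevel_bornologous (f : RootedCoarseMap S T) {κ : ℝ → ℝ}
    (κ_lip : ∀ h h', |κ h - κ h'| ≤ |h - h'|) (t : unitInterval) {R : ℝ} (hR : 0 < R) :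
    ∃ Q > 0, ∀ x y, dist x y < R → |interpLevel f κ t x - interpLevel f κ t y| < Q := by
  obtain ⟨P, hP, h⟩ := f.coarse.bornologous R hR
  refine ⟨2 * P + 2 * R, by positivity, fun x y hxy => ?_⟩
  have h₀ := t.2.1
  have h₁ := sub_nonneg.2 t.2.2
  have e : interpLevel f κ t x - interpLevel f κ t y =
      (1 - t) * (ht (f.map x) - ht (f.map y)) + t * (κ (ht x) - κ (ht y)) := by
    unfold interpLevel; ring
  have a₁ : |ht (f.map x) - ht (f.map y)| < 2 * P :=
    (abs_ht_sub_le_dist _ _).trans_lt (by linarith [h x y hxy])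
  have a₂ : |κ (ht x) - κ (ht y)| < 2 * R :=
    (κ_lip _ _).trans_lt ((abs_ht_sub_le_dist _ _).trans_lt (by linarith))
  rw [e]
  refine (abs_add_le _ _).trans_lt ?_
  rw [abs_mul, abs_mul, abs_of_nonneg h₀, abs_of_nonneg h₁]
  have b₁ := mul_le_of_le_one_left (abs_nonneg (ht (f.map x) - ht (f.map y)))
    (by linarith : 1 - (t : ℝ) ≤ 1)
  have b₂ := mul_le_of_le_one_left (abs_nonneg (κ (ht x) - κ (ht y))) t.2.2
  linarith

lemma interpLevel_proper (f : RootedCoarseMap S T) {κ : ℝ → ℝ}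
    (κ_proper : ∀ n : ℕ, ∃ M : ℕ, ∀ h : ℝ, M ≤ h → n ≤ κ h) (n : ℕ) :
    ∃ N : ℕ, ∀ (t : unitInterval) (x : S.Space), N ≤ ht x → n ≤ interpLevel f κ t x := by
  obtain ⟨N, hN⟩ := κ_proper n
  obtain ⟨M, hM⟩ := exists_le_ht f n
  refine ⟨max N M, fun t x hx => ?_⟩
  rw [Nat.cast_max, max_le_iff] at hx
  have h₁ := mul_le_mul_of_nonneg_left (hM x hx.2) (sub_nonneg.2 t.2.2)
  have h₂ := mul_le_mul_of_nonneg_left (hN _ hx.1) t.2.1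
  have h₃ := sub_nonneg.2 t.2.2
  unfold interpLevel
  linarith

lemma continuous_interpLevel (f : RootedCoarseMap S T) {κ : ℝ → ℝ}
    (κ_lip : ∀ h h', |κ h - κ h'| ≤ |h - h'|) :
    Continuous fun p : unitInterval × S.Space => interpLevel f κ p.1 p.2 := by
  have hκ : Continuous κ := (LipschitzWith.of_dist_le_mul (K := 1) fun x y => by
    rw [Real.dist_eq, Real.dist_eq]; simpa using κ_lip x y).continuous
  have h := continuous_ht (T := S)
  have h' := continuous_ht (T := T)
  unfold interpLevel
  fun_prop

/-- The truncation of the map `f` at the level `κ`. -/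
noncomputable def truncMap (f : RootedCoarseMap S T) {κ : ℝ → ℝ} (κ_nonneg : ∀ h, 0 ≤ κ h)
    (κ_lip : ∀ h h', |κ h - κ h'| ≤ |h - h'|)
    (κ_proper : ∀ n : ℕ, ∃ M : ℕ, ∀ h : ℝ, M ≤ h → n ≤ κ h) : RootedCoarseMap S T where
  map := ⟨fun x => trunc (interpLevel f κ 1 x) (f.map x),
    continuous_trunc ((continuous_interpLevel f κ_lip).comp (by fun_prop :
      Continuous fun x : S.Space => ((1 : unitInterval), x))) f.map.continuous
      (interpLevel_nonneg f κ_nonneg 1)⟩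
  map_base := by
    change trunc _ (f.map S.base) = _
    rw [f.map_base]
    exact trunc_base (interpLevel_nonneg f κ_nonneg 1 _)
  coarse := isCoarseMap_trunc f (interpLevel_nonneg f κ_nonneg 1)
    (fun _ hR => interpLevel_bornologous f κ_lip 1 hR)
    (fun n => (interpLevel_proper f κ_proper n).imp fun _ h => h 1)

/-- The truncation level slides linearly to `κ`. A convex combination of two proper levels is proper
uniformly in time, and the Lipschitz bound on `κ` keeps every stage bornologous. -/
lemma homotopic_truncMap (f : RootedCoarseMap S T) {κ : ℝ → ℝ} (κ_nonneg : ∀ h, 0 ≤ κ h)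
    (κ_lip : ∀ h h', |κ h - κ h'| ≤ |h - h'|)
    (κ_proper : ∀ n : ℕ, ∃ M : ℕ, ∀ h : ℝ, M ≤ h → n ≤ κ h) :
    rootedCoarseHomotopic f (truncMap f κ_nonneg κ_lip κ_proper) := by
  refine ⟨⟨⟨fun p => trunc (interpLevel f κ p.1 p.2) (f.map p.2), ?_⟩, fun x => ?_, fun x => rfl⟩,
    fun t => ?_, ?_, fun t => ?_⟩
  · exact continuous_trunc (continuous_interpLevel f κ_lip) (by fun_prop)
      fun p => interpLevel_nonneg f κ_nonneg p.1 p.2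
  -- At time `0` the level is `ht (f.map x) + 1`, high enough to leave `f.map x` in place.
  · exact trunc_of_ht_add_one_le (by simp [interpLevel])
  · change trunc _ (f.map S.base) = _
    rw [f.map_base, trunc_base (interpLevel_nonneg f κ_nonneg t _)]
  · refine (properHomotopy_iff_ht
      (H := fun (t : unitInterval) x => trunc (interpLevel f κ t x) (f.map x))).2 fun n => ?_
    obtain ⟨N, hN⟩ := interpLevel_proper f κ_proper n
    obtain ⟨M, hM⟩ := exists_le_ht f n
    refine ⟨max N M, fun t x hx => ?_⟩
    rw [Nat.cast_max, max_le_iff] at hx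
    exact le_ht_trunc (hM x hx.2) (hN t x hx.1)
  · exact isCoarseMap_trunc f (interpLevel_nonneg f κ_nonneg t)
      (fun _ hR => interpLevel_bornologous f κ_lip t hR)
      (fun n => (interpLevel_proper f κ_proper n).imp fun _ h => h t)

lemma homotopic_of_represents {f g : RootedCoarseMap S T}
    {s : InverseSequence.SeqHom S.levels T.levels} (hf : Represents f.map s)
    (hg : Represents g.map s) : rootedCoarseHomotopic f g := by
  have h : ∀ n : ℕ, ∃ N : ℕ, ∀ x, N ≤ ht x → trunc n (f.map x) = trunc n (g.map x) := by
    intro n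
    obtain ⟨N, h₁, hN⟩ := hf n
    obtain ⟨M, -, hM⟩ := hg n
    refine ⟨max N M, fun x hx => ?_⟩
    rw [Nat.cast_max, max_le_iff] at hx
    obtain ⟨a, ha⟩ := exists_level ((Nat.cast_le.2 h₁).trans hx.1)
    rw [hN x hx.1 a ha, hM x hx.2 a ha]
  choose N hN using h
  obtain ⟨M, hM, -, hNM⟩ := exists_strictMono_ge N
  obtain ⟨κ, κ_nonneg, κ_lip, κ_slow, κ_proper⟩ := exists_slow_function M hM
  -- The slow level never exceeds an integer level at which `f` and `g` already agree.
  have e : truncMap f κ_nonneg κ_lip κ_proper = truncMap g κ_nonneg κ_lip κ_proper := by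
    refine RootedCoarseMap.ext (ContinuousMap.ext fun x => ?_)
    change trunc _ (f.map x) = trunc _ (g.map x)
    have hκ : ∀ f' : RootedCoarseMap S T, interpLevel f' κ 1 x = κ (ht x) := fun f' => by
      simp [interpLevel]
    rw [hκ, hκ]
    obtain ⟨n, hn, hle⟩ := κ_slow (ht x)
    refine trunc_congr (n := n) ?_ (κ_nonneg _) hle
    rcases eq_or_ne n 0 with rfl | h₀
    · rw [Nat.cast_zero, trunc_zero, trunc_zero]
    · exact hN n x ((Nat.cast_le.2 (hNM n h₀)).trans (hn.resolve_left h₀))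
  have hc := (inferInstance : Congruence rootedCoarseHomotopic.{u}).equivalence (X := S) (Y := T)
  refine hc.trans (homotopic_truncMap f κ_nonneg κ_lip κ_proper) ?_
  rw [e]
  exact hc.symm (homotopic_truncMap g κ_nonneg κ_lip κ_proper)

end RootedSimplicialTree

/-! ### Constructing maps from morphisms of levels: fullness -/

/-- The largest `n` with `N n ≤ k`, for strictly increasing `N` starting at `0`. -/
lemma exists_level_function {N : ℕ → ℕ} (hN : StrictMono N) (h₀ : N 0 = 0) :
    ∃ l : ℕ → ℕ, (∀ n k, n ≤ l k ↔ N n ≤ k) ∧ ∀ k, l (k + 1) = l k ∨ l (k + 1) = l k + 1 := by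
  have key : ∀ n k, n ≤ Nat.findGreatest (fun n => N n ≤ k) k ↔ N n ≤ k := by
    intro n k
    refine ⟨fun h => (hN.monotone h).trans ?_, fun h => Nat.le_findGreatest (hN.le_apply.trans h) h⟩
    exact Nat.findGreatest_spec (P := fun n => N n ≤ k) (Nat.zero_le k) (by simp [h₀])
  refine ⟨fun k => Nat.findGreatest (fun n => N n ≤ k) k, key, fun k => ?_⟩
  dsimp only
  generalize hl : Nat.findGreatest (fun n => N n ≤ k) k = p
  generalize hl' : Nat.findGreatest (fun n => N n ≤ k + 1) (k + 1) = q
  have h₁ : p ≤ q := by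
    rw [← hl', key]
    exact ((key p k).1 hl.ge).trans k.le_succ
  have h₂ : q ≤ p + 1 := by
    by_contra h
    have h₃ : N (p + 2) ≤ k + 1 := (key _ _).1 (by omega)
    have h₄ : N (p + 1) < N (p + 2) := hN (Nat.lt_succ_self _)
    have h₅ := (key (p + 1) k).2 (by omega)
    omega
  omega

namespace RootedSimplicialTree

open GraphRealization

variable {S T : RootedSimplicialTree.{u}}

/-- A map of vertices which preserves edges up to collapsing and is proper extends to a rooted
coarse map. -/
lemma exists_rootedCoarseMap_of_vertexMap (φ : S.V → T.V) (hroot : φ S.root = T.root)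
    (hadj : ∀ a b, S.graph.Adj a b → φ a = φ b ∨ T.graph.Adj (φ a) (φ b))
    (hproper : ∀ n, ∃ N, ∀ v, N ≤ S.depth v → n ≤ T.depth (φ v)) :
    ∃ f : RootedCoarseMap S T, ∀ v, f.map (S.pt v) = T.pt (φ v) := by
  set L : LinearEdgeMap S.graph T.graph := LinearEdgeMap.ofVertexMap φ hadj with hL
  have lin_single : ∀ v r, L.lin (Finsupp.single v r) = Finsupp.single (φ v) r := fun v r => by
    simp [hL, LinearEdgeMap.ofVertexMap]
  let F : S.Space → T.Space := L.toMap
  have hF : ∀ x, (F x).1 = L.lin x.1 := fun x => rfl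
  have hpt : ∀ v, F (S.pt v) = T.pt (φ v) := fun v => Subtype.ext (by
    rw [hF, pt_val, pt_val, lin_single])
  have hdist : ∀ x y, dist (F x) (F y) ≤ dist x y := dist_toMap_le L
  have hc : Continuous F := (LipschitzWith.of_dist_le_mul (K := 1) fun x y => by
    simpa using hdist x y).continuous
  refine ⟨⟨⟨F, hc⟩, ?_, metricallyProper_iff_ht.2 fun n => ?_,
    fun R hR => ⟨R, hR, fun x y h => (hdist x y).trans_lt h⟩⟩, hpt⟩
  · change F S.base = _
    rw [← pt_root, hpt, hroot, pt_root]
  · obtain ⟨N, hN⟩ := hproper n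
    -- At height `N + 1` even the lower end of the edge containing `x` has depth at least `N`.
    refine ⟨N + 1, fun x hx => ?_⟩
    change (n : ℝ) ≤ ht (F x)
    rcases exists_eq_par_of_pos x with ⟨a, rfl⟩ | ⟨b, s, h₀, h₁, hd, e⟩
    · rw [hpt, ht_pt]
      rw [ht_pt] at hx
      have hx' : N + 1 ≤ S.depth a := by exact_mod_cast hx
      exact_mod_cast hN a (by omega)
    · have e' : (F x).1 = (1 - s) • Finsupp.single (φ (S.par b)) 1 +
          s • Finsupp.single (φ b) 1 := by
        rw [hF, e, map_add, map_smul, map_smul, lin_single, lin_single]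
      rw [ht_of_eq e']
      rw [ht_of_eq e, hd] at hx
      have hp : N ≤ S.depth (S.par b) := by
        have : (N : ℝ) ≤ S.depth (S.par b) := by push_cast at hx; linarith
        exact_mod_cast this
      have a₁ : (n : ℝ) ≤ T.depth (φ (S.par b)) := by exact_mod_cast hN _ hp
      have a₂ : (n : ℝ) ≤ T.depth (φ b) := by exact_mod_cast hN b (by omega)
      have b₁ := mul_le_mul_of_nonneg_left a₁ (sub_nonneg.2 h₁)
      have b₂ := mul_le_mul_of_nonneg_left a₂ h₀.le
      linarith

/-- A compatible family of maps from the vertices of `S` far from the root to the levels of `T` is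
induced by a rooted coarse map. -/
lemma exists_rootedCoarseMap_of_levelMaps (N : ℕ → ℕ) (hN : StrictMono N) (h₀ : N 0 = 0)
    (A : ℕ → S.V → T.V) (hA : ∀ n v, N n ≤ S.depth v → T.depth (A n v) = n)
    (hanc : ∀ n v, N (n + 1) ≤ S.depth v → T.anc n (A (n + 1) v) = A n v)
    (hpar : ∀ n v, N n < S.depth v → A n (S.par v) = A n v) :
    ∃ f : RootedCoarseMap S T, ∀ n v, N n ≤ S.depth v →
      trunc n (f.map (S.pt v)) = T.pt (A n v) := by
  obtain ⟨l, hl, hl'⟩ := exists_level_function hN h₀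
  -- Each vertex goes to the deepest level available at its depth.
  set φ : S.V → T.V := fun v => A (l (S.depth v)) v with hφ
  have hNl : ∀ v, N (l (S.depth v)) ≤ S.depth v := fun v => (hl _ _).1 le_rfl
  have hdepth : ∀ v, T.depth (φ v) = l (S.depth v) := fun v => hA _ _ (hNl v)
  have hanc' : ∀ k n v, N (n + k) ≤ S.depth v → T.anc n (A (n + k) v) = A n v := by
    intro k
    induction k with
    | zero => exact fun n v h => T.anc_of_depth_le (hA n v h).le
    | succ k ih =>
      intro n v h
      have h' : N (n + k) ≤ S.depth v := (hN.monotone (by omega)).trans h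
      rw [← ih n v h', ← hanc (n + k) v h, anc_anc, min_eq_left (by omega), add_assoc]
  have hφanc : ∀ n v, N n ≤ S.depth v → T.anc n (φ v) = A n v := by
    intro n v h
    obtain ⟨k, hk⟩ := Nat.exists_eq_add_of_le ((hl n _).2 h)
    have := hNl v
    simp only [hφ]
    rw [hk] at this ⊢
    exact hanc' k n v this
  have hroot : φ S.root = T.root := T.eq_root_of_depth_eq_zero (by
    rw [hdepth, depth_root]
    by_contra h
    have := (hl 1 0).1 (by omega)
    have := hN zero_lt_one
    omega)
  have hparφ : ∀ b, S.depth b ≠ 0 → φ (S.par b) = φ b ∨ T.graph.Adj (φ (S.par b)) (φ b) := by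
    intro b hb
    obtain ⟨k, hk⟩ := Nat.exists_eq_succ_of_ne_zero hb
    have hk' : S.depth (S.par b) = k := by rw [depth_par, hk]; rfl
    have hlt : N (l k) < S.depth b := by rw [hk]; exact Nat.lt_succ_of_le ((hl _ _).1 le_rfl)
    -- Along an edge the available level is unchanged, and the edge collapses, or it rises by one,
    -- and the edge maps to an edge.
    rcases hl' k with h | h
    · left
      simp only [hφ]
      rw [hk', hk, Nat.succ_eq_add_one, h, hpar _ _ hlt]
    · right
      have hd : T.depth (φ b) = l k + 1 := by rw [hdepth, hk, Nat.succ_eq_add_one, h]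
      have e : φ (S.par b) = T.par (φ b) := by
        have h₁ := T.par_anc_succ (n := l k) (v := φ b) (by omega)
        rw [T.anc_of_depth_le hd.le] at h₁
        rw [h₁, hφanc _ _ hlt.le, ← hpar _ _ hlt]
        simp only [hφ]
        rw [hk']
      rw [e]
      exact T.adj_par (by omega)
  obtain ⟨f, hf⟩ := exists_rootedCoarseMap_of_vertexMap φ hroot
    (fun a b hab => by
      rcases S.depth_eq_add_one_of_adj hab with h | h
      · have := hparφ a (by omega)
        rw [S.par_eq_of_adj hab.symm h] at this
        exact this.imp Eq.symm SimpleGraph.Adj.symm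
      · have := hparφ b (by omega)
        rwa [S.par_eq_of_adj hab h] at this)
    (fun n => ⟨N n, fun v hv => by rw [hdepth]; exact (hl _ _).2 hv⟩)
  exact ⟨f, fun n v hv => by rw [hf, trunc_natCast_pt, hφanc n v hv]⟩

open InverseSequence

lemma exists_rootedCoarseMap_represents (s : SeqHom S.levels T.levels) :
    ∃ f : RootedCoarseMap S T, Represents f.map s := by
  classical
  choose m h₁ h₂ hm using fun n => s.compat n (n + 1) n.le_succ
  -- The bound `m (n - 1)` makes the components at `n - 1` and `n` strictly compatible from depth `N
  -- n` on. Nothing is required at `n = 0`, so truncated subtraction is harmless.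
  obtain ⟨N, hN, h₀, hNm⟩ := exists_strictMono_ge fun n => max (s.index n) (m (n - 1))
  have hNi : ∀ n, n ≠ 0 → s.index n ≤ N n := fun n hn => (le_max_left _ _).trans (hNm n hn)
  have hNm' : ∀ n, m n ≤ N (n + 1) := fun n => (le_max_right _ _).trans (hNm (n + 1) (by omega))
  let up : ∀ (n : ℕ) (v : S.V), n ≤ S.depth v → S.levels.term n := fun n v h =>
    ⟨S.anc n v, by rw [depth_anc, min_eq_left h]⟩
  have up_bond : ∀ {n k : ℕ} (h : n ≤ k) (v : S.V) (hv : k ≤ S.depth v),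
      S.levels.bond h (up k v hv) = up n v (h.trans hv) := fun {n k} h v hv => levels_ext (by
    rw [levels_bond_val]
    exact (S.anc_anc _ _ _).trans (by rw [min_eq_left h]))
  let B : ℕ → S.V → T.V := fun n v =>
    if h : s.index n ≤ S.depth v then (s.app n (up _ v h)).1 else T.root
  have hB : ∀ n v (h : s.index n ≤ S.depth v), B n v = (s.app n (up _ v h)).1 := fun n v h =>
    dif_pos h
  -- As `N 0 = 0` may lie below `s.index 0`, level `0` is treated separately; the root is its only
  -- vertex.
  let A : ℕ → S.V → T.V := fun n v => if n = 0 then T.root else B n v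
  have hA : ∀ n, n ≠ 0 → A n = B n := fun n hn => by funext v; exact if_neg hn
  have hA₀ : ∀ v, A 0 v = T.root := fun v => if_pos rfl
  have hdepth : ∀ n v, N n ≤ S.depth v → T.depth (A n v) = n := by
    intro n v h
    rcases eq_or_ne n 0 with rfl | hn
    · rw [hA₀, depth_root]
    · rw [hA n hn, hB n v ((hNi n hn).trans h)]
      exact (s.app n _).2
  obtain ⟨f, hf⟩ := exists_rootedCoarseMap_of_levelMaps N hN h₀ A hdepth
    (fun n v h => by
      rcases eq_or_ne n 0 with rfl | hn
      · rw [hA₀, anc_zero]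
      · have hv := (hNm' n).trans h
        rw [hA n hn, hA _ n.succ_ne_zero, hB n v ((h₁ n).trans hv),
          hB (n + 1) v ((h₂ n).trans hv), ← up_bond (h₁ n) v hv, ← up_bond (h₂ n) v hv]
        exact congrArg Subtype.val (congrArg
          (fun φ : S.levels.term (m n) ⟶ T.levels.term n => φ (up (m n) v hv)) (hm n)).symm)
    (fun n v h => by
      rcases eq_or_ne n 0 with rfl | hn
      · rw [hA₀, hA₀]
      · have hi := hNi n hn
        have hv : s.index n ≤ S.depth (S.par v) := by rw [depth_par]; omega
        rw [hA n hn, hB n v (by omega), hB n (S.par v) hv]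
        congr 2
        exact levels_ext (S.anc_par (by omega)))
  refine ⟨f, Represents.of_vertices fun n => ⟨max (N n) (s.index n), le_max_right _ _,
    fun v hv a ha => ?_⟩⟩
  rw [max_le_iff] at hv
  rw [hf n v hv.1]
  congr 1
  rcases eq_or_ne n 0 with rfl | hn
  · rw [hA₀]
    exact (T.eq_root_of_depth_eq_zero (s.app 0 a).2).symm
  · rw [hA n hn, hB n v hv.2]
    congr 2
    exact levels_ext ha

end RootedSimplicialTree

/-! ### Trees presented by parent maps -/

/-- Data presenting a rooted tree: each vertex has a parent, one step closer to the root. -/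
structure ParentMap (V : Type u) where
  /-- the root -/
  root : V
  /-- the parent of a vertex -/
  par : V → V
  /-- the depth of a vertex -/
  depth : V → ℕ
  depth_par : ∀ v, depth (par v) = depth v - 1
  eq_root : ∀ v, depth v = 0 → v = root
  depth_root : depth root = 0

namespace ParentMap

variable {V : Type u} (P : ParentMap V)

/-- The graph joining each vertex to its parent. -/
def graph : SimpleGraph V where
  Adj a b := a ≠ b ∧ (P.par a = b ∨ P.par b = a)
  symm := ⟨fun _ _ h => ⟨h.1.symm, h.2.symm⟩⟩
  loopless := ⟨fun _ h => h.1 rfl⟩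

lemma adj_par {v : V} (h : P.depth v ≠ 0) : P.graph.Adj (P.par v) v := by
  refine ⟨fun e => ?_, Or.inr rfl⟩
  have := P.depth_par v
  rw [e] at this
  omega

lemma reachable_root (v : V) : P.graph.Reachable P.root v := by
  induction h : P.depth v generalizing v with
  | zero => rw [P.eq_root v h]
  | succ n ih =>
    exact (ih (P.par v) (by rw [P.depth_par, h]; rfl)).trans (P.adj_par (by omega)).reachable

lemma depth_iterate_le (k : ℕ) (v : V) : P.depth (P.par^[k] v) ≤ P.depth v := by
  induction k generalizing v with
  | zero => exact le_rfl
  | succ k ih =>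
    rw [Function.iterate_succ_apply]
    exact (ih _).trans (by rw [P.depth_par]; omega)

/-- A walk avoiding this edge cannot leave the set of descendants of `w`, and the parent of `w` is
too shallow to belong to it. -/
lemma isBridge_par {w : V} (hw : P.depth w ≠ 0) : P.graph.IsBridge s(w, P.par w) := by
  rw [SimpleGraph.isBridge_iff]
  rintro ⟨p⟩
  have key : ∀ {a b : V}, (P.graph.deleteEdges {s(w, P.par w)}).Walk a b →
      (∃ k, P.par^[k] a = w) → ∃ k, P.par^[k] b = w := by
    intro a b q
    induction q with
    | nil => exact id
    | @cons a c _ h _ ih =>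
      rintro ⟨k, hk⟩
      refine ih ?_
      rw [SimpleGraph.deleteEdges_adj] at h
      obtain ⟨⟨-, h' | h'⟩, hne⟩ := h
      · cases k with
        | zero =>
          obtain rfl : a = w := hk
          exact absurd (by rw [h']; rfl) hne
        | succ k => exact ⟨k, by rwa [Function.iterate_succ_apply, h'] at hk⟩
      · exact ⟨k + 1, by rwa [Function.iterate_succ_apply, h']⟩
  obtain ⟨k, hk⟩ := key p ⟨0, rfl⟩
  have := P.depth_iterate_le k (P.par w)
  rw [hk, P.depth_par] at this
  omega

lemma eq_of_depth_eq_zero_of_par {a b : V} (h : P.par a = b) (ha : P.depth a = 0) : a = b := by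
  rw [P.eq_root a ha, P.eq_root b (by rw [← h, P.depth_par, ha])]

lemma isTree : P.graph.IsTree where
  connected :=
    { preconnected := fun a b => (P.reachable_root a).symm.trans (P.reachable_root b)
      nonempty := ⟨P.root⟩ }
  isAcyclic := by
    rw [SimpleGraph.isAcyclic_iff_forall_adj_isBridge]
    rintro a b ⟨hne, h | h⟩
    · rw [← h]
      exact P.isBridge_par fun ha => hne (P.eq_of_depth_eq_zero_of_par h ha)
    · rw [← h, Sym2.eq_swap]
      exact P.isBridge_par fun hb => hne (P.eq_of_depth_eq_zero_of_par h hb).symm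

/-- The rooted tree presented by a parent map. -/
def tree : RootedSimplicialTree.{u} where
  V := V
  graph := P.graph
  isTree := P.isTree
  root := P.root

lemma depth_le_add_one_of_adj {a b : V} (h : P.graph.Adj a b) : P.depth b ≤ P.depth a + 1 := by
  have ha := P.depth_par a
  have hb := P.depth_par b
  rcases h.2 with h | h
  · rw [h] at ha; omega
  · rw [h] at hb; omega

/-- Following parents bounds the distance above; an edge raises the prescribed depth by at most one,
which bounds it below. -/
lemma tree_depth (v : V) : P.tree.depth v = P.depth v := by
  refine le_antisymm ?_ ?_
  · induction h : P.depth v generalizing v with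
    | zero => rw [P.eq_root v h]; exact P.tree.depth_root.le
    | succ n ih =>
      have h₁ := ih (P.par v) (by rw [P.depth_par, h]; rfl)
      have h₂ := P.tree.depth_eq_add_one_of_adj (P.adj_par (by omega : P.depth v ≠ 0))
      omega
  · have key : ∀ {a b : V} (q : P.graph.Walk a b), P.depth b ≤ P.depth a + q.length := by
      intro a b q
      induction q with
      | nil => exact le_rfl
      | cons h q ih =>
        have := P.depth_le_add_one_of_adj h
        rw [SimpleGraph.Walk.length_cons]
        omega
    obtain ⟨q, hq⟩ := P.isTree.connected.exists_walk_length_eq_dist P.root v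
    have := key q
    rw [P.depth_root, hq, zero_add] at this
    exact this

lemma tree_par {v : V} (h : P.depth v ≠ 0) : P.tree.par v = P.par v :=
  P.tree.par_eq_of_adj (P.adj_par h) (by
    rw [tree_depth, tree_depth, P.depth_par]; omega)

end ParentMap

/-! ### The tree of an inverse sequence: essential surjectivity -/

namespace InverseSequence

variable (X : InverseSequence (Type u))

/-- The tree of an inverse sequence of sets: a root below the disjoint union of
the terms of the sequence. -/
def parentMap : ParentMap (Option (Σ n : ℕ, X.term n)) where
  root := none
  par
    | none => none
    | some ⟨0, _⟩ => none
    | some ⟨n + 1, x⟩ => some ⟨n, X.bond n.le_succ x⟩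
  depth v := v.elim 0 fun p => p.1 + 1
  depth_par := by
    rintro (_ | ⟨_ | n, x⟩) <;> rfl
  eq_root := by
    rintro (_ | ⟨n, x⟩) h
    · rfl
    · exact absurd h (Nat.succ_ne_zero _)
  depth_root := rfl

/-- The tree of an inverse sequence of sets. -/
def tree : RootedSimplicialTree.{u} := X.parentMap.tree

/-- The vertex of the tree given by an element of a term of the sequence. -/
def node {n : ℕ} (x : X.term n) : X.tree.V := some ⟨n, x⟩

lemma depth_node {n : ℕ} (x : X.term n) : X.tree.depth (X.node x) = n + 1 :=
  X.parentMap.tree_depth _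

lemma node_injective {n : ℕ} : Function.Injective (X.node (n := n)) := fun _ _ h =>
  eq_of_heq (Sigma.mk.inj (Option.some.inj h)).2

lemma exists_node {n : ℕ} {v : X.tree.V} (h : X.tree.depth v = n + 1) :
    ∃ x : X.term n, X.node x = v := by
  have h' : X.parentMap.depth v = n + 1 := (X.parentMap.tree_depth v).symm.trans h
  rcases v with _ | ⟨k, x⟩
  · exact absurd h' (Nat.succ_ne_zero n).symm
  · obtain rfl : k = n := Nat.succ_injective h'
    exact ⟨x, rfl⟩

lemma par_node {n : ℕ} (x : X.term (n + 1)) :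
    X.tree.par (X.node x) = X.node (X.bond n.le_succ x) :=
  X.parentMap.tree_par (Nat.succ_ne_zero _)

lemma anc_node {n m : ℕ} (h : n ≤ m) (x : X.term m) :
    X.tree.anc (n + 1) (X.node x) = X.node (X.bond h x) := by
  induction m, h using Nat.le_induction with
  | base =>
    rw [X.tree.anc_of_depth_le (X.depth_node x).le]
    congr 1
    exact (ConcreteCategory.congr_hom (X.sys.map_id (Opposite.op n)) x).symm
  | succ m h ih =>
    rw [← X.tree.anc_par (by rw [X.depth_node]; omega), par_node, ih]
    congr 1
    exact ConcreteCategory.congr_hom (X.bond_comp h m.le_succ) x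

/-- The map from an inverse sequence to the levels of its tree. -/
noncomputable def toLevels : SeqHom X X.tree.levels where
  index n := n
  -- The node of `x` has depth `n + 1` because of the added root, so it is moved down one step to
  -- reach level `n`.
  app n := TypeCat.ofHom fun x => ⟨X.tree.anc n (X.node x), by
    change X.tree.depth _ = n
    rw [RootedSimplicialTree.depth_anc, depth_node]; omega⟩
  compat n n' h := ⟨n', h, le_rfl, by
    ext x
    refine RootedSimplicialTree.levels_ext ?_
    change X.tree.anc n (X.node (X.bond h x)) =
      X.tree.anc n (X.tree.anc n' (X.node (X.bond le_rfl x)))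
    rw [← anc_node, ← anc_node, RootedSimplicialTree.anc_anc, RootedSimplicialTree.anc_anc,
      RootedSimplicialTree.anc_anc]
    congr 1
    omega⟩

/-- The element of a term of the sequence given by a vertex of its tree. -/
noncomputable def ofLevel (n : ℕ) (v : X.tree.levels.term (n + 1)) : X.term n :=
  (X.exists_node v.2).choose

lemma node_ofLevel (n : ℕ) (v : X.tree.levels.term (n + 1)) : X.node (X.ofLevel n v) = v.1 :=
  (X.exists_node v.2).choose_spec

lemma bond_ofLevel {n m : ℕ} (h : n ≤ m) (v : X.tree.levels.term (m + 1)) :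
    X.bond h (X.ofLevel m v) = X.ofLevel n (X.tree.levels.bond (Nat.succ_le_succ h) v) := by
  refine X.node_injective ?_
  rw [← anc_node, node_ofLevel, node_ofLevel, RootedSimplicialTree.levels_bond_val]

/-- The map from the levels of the tree of an inverse sequence back to the sequence. -/
noncomputable def fromLevels : SeqHom X.tree.levels X where
  index n := n + 1
  app n := TypeCat.ofHom (X.ofLevel n)
  compat n n' h := ⟨n' + 1, Nat.succ_le_succ h, le_rfl, by
    ext v
    change X.ofLevel n (X.tree.levels.bond (Nat.succ_le_succ h) v) =
      X.bond h (X.ofLevel n' (X.tree.levels.bond (Nat.succ_le_succ (le_refl n')) v))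
    rw [← bond_ofLevel X h, ← bond_ofLevel X le_rfl]
    exact congrArg _ (ConcreteCategory.congr_hom (X.sys.map_id (Opposite.op n')) _).symm⟩

/-- The composite consists of the bonding maps from `n + 1` to `n`, and these represent the
identity. -/
lemma toLevels_fromLevels : equivRel (X.toLevels.comp X.fromLevels) (SeqHom.id X) := fun n =>
  ⟨n + 1, le_rfl, n.le_succ, by
    ext x
    refine X.node_injective ((X.node_ofLevel _ _).trans ?_)
    change X.tree.anc (n + 1) (X.node (X.bond (le_refl (n + 1)) x)) = X.node (X.bond n.le_succ x)
    rw [← anc_node, ← anc_node, RootedSimplicialTree.anc_anc]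
    congr 1
    omega⟩

lemma fromLevels_toLevels : equivRel (X.fromLevels.comp X.toLevels) (SeqHom.id X.tree.levels) :=
  fun n => ⟨n + 1, le_rfl, n.le_succ, by
    ext v
    refine RootedSimplicialTree.levels_ext ?_
    change X.tree.anc n (X.node (X.ofLevel n (X.tree.levels.bond (le_refl (n + 1)) v))) =
      X.tree.anc n v.1
    rw [node_ofLevel, RootedSimplicialTree.levels_bond_val, RootedSimplicialTree.anc_anc]
    congr 1
    omega⟩

end InverseSequence

/-! ### The levels functor is an equivalence -/

namespace RootedSimplicialTree

open InverseSequence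

/-- The functor sending a rooted tree to its inverse sequence of levels, before passing to homotopy
classes. -/
noncomputable def levelsFunctorAux : RootedSimplicialTree.{u} ⥤ TowerSet.{u} where
  obj T := ⟨T.levels⟩
  -- The choice is immaterial: any two representing morphisms are equivalent, which also gives
  -- functoriality.
  map f := (CategoryTheory.Quotient.functor equivRel).map (exists_represents f).choose
  map_id T := CategoryTheory.Quotient.sound equivRel
    (Represents.equivRel (exists_represents (𝟙 T)).choose_spec represents_id)
  map_comp f g := CategoryTheory.Quotient.sound equivRel
    (Represents.equivRel (exists_represents (f ≫ g)).choose_spec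
      ((exists_represents f).choose_spec.comp (exists_represents g).choose_spec))

lemma levelsFunctorAux_map_eq {S T : RootedSimplicialTree.{u}} (f g : S ⟶ T)
    (h : rootedCoarseHomotopic f g) : levelsFunctorAux.map f = levelsFunctorAux.map g :=
  CategoryTheory.Quotient.sound equivRel (Represents.equivRel
    ((exists_represents f).choose_spec.of_homotopic h) (exists_represents g).choose_spec)

/-- The functor sending a rooted tree to its inverse sequence of levels. -/
noncomputable def levelsFunctor : CoarseTreeCat.{u} ⥤ TowerSet.{u} :=
  CategoryTheory.Quotient.lift rootedCoarseHomotopic levelsFunctorAux fun _ _ f g h =>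
    levelsFunctorAux_map_eq f g h

instance : levelsFunctor.{u}.Faithful where
  map_injective {S T} f g h := by
    obtain ⟨f, rfl⟩ := (CategoryTheory.Quotient.functor rootedCoarseHomotopic).map_surjective f
    obtain ⟨g, rfl⟩ := (CategoryTheory.Quotient.functor rootedCoarseHomotopic).map_surjective g
    refine CategoryTheory.Quotient.sound rootedCoarseHomotopic ?_
    have h' := (CategoryTheory.Quotient.functor_map_eq_iff equivRel _ _).1 h
    exact homotopic_of_represents ((exists_represents f).choose_spec.of_equivRel h')
      (exists_represents g).choose_spec

instance : levelsFunctor.{u}.Full where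
  map_surjective {S T} s := by
    obtain ⟨s, rfl⟩ := (CategoryTheory.Quotient.functor equivRel).map_surjective s
    obtain ⟨f, hf⟩ := exists_rootedCoarseMap_represents s
    exact ⟨(CategoryTheory.Quotient.functor rootedCoarseHomotopic).map f, CategoryTheory.Quotient.sound equivRel
      (Represents.equivRel (exists_represents f).choose_spec hf)⟩

instance : levelsFunctor.{u}.EssSurj where
  mem_essImage X := ⟨⟨X.as.tree⟩, ⟨
    { hom := (CategoryTheory.Quotient.functor equivRel).map X.as.fromLevels
      inv := (CategoryTheory.Quotient.functor equivRel).map X.as.toLevels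
      hom_inv_id := CategoryTheory.Quotient.sound equivRel X.as.fromLevels_toLevels
      inv_hom_id := CategoryTheory.Quotient.sound equivRel X.as.toLevels_fromLevels }⟩⟩

instance : levelsFunctor.{u}.IsEquivalence where

end RootedSimplicialTree

theorem corollary6p4 : Nonempty (TowerSet.{u} ≌ CoarseTreeCat.{u}) :=
  ⟨RootedSimplicialTree.levelsFunctor.asEquivalence.symm⟩
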